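/- Let $n\ge 1$ and let $M,N\subset\mathbb{R}^{n+1}$ be compact connected smooth embedded $n$-manifolds without boundary, oriented by their outer unit normal fields. For such a manifold $X$ with outer unit normal $\eta$ let $\omega_X=i_{\eta}(dx_1\wedge\dots\wedge dx_{n+1})$ be its volume form and $\operatorname{Vol}(X)=\int_X\omega_X$; for a diffeomorphism $h:X\to Y$ of such manifolds let $J(h)$ be its Jacobian, $h^*\omega_Y=J(h)\,\omega_X$, and let $\Phi_1(h)=\int_X(|J(h)|-1)^2\,\omega_X$. Let $F:[0,1]\times M\to\mathbb{R}^{n+1}$ be a $C^2$ morph from $M$ to $N$ that starts at the identity: $F$ is of class $C^2$; for each $t\in[0,1]$ the map $f^t=F(t,\cdot)$ is a $C^2$ diffeomorphism of $M$ onto its image $M^t=F(t,M)$, which is again a compact connected smooth embedded $n$-manifold without boundary, oriented by its outer unit normal; $f^0=\mathrm{id}_M$; and $M^1=N$. For $s,t\in[0,1]$ put $f^{s,t}=f^t\circ(f^s)^{-1}:M^s\to M^t$ and $E^{s,t}=\Phi_1(f^{s,t})$. Let $k\in\{1,2,\dots,\infty\}$ and suppose that $F$ is pairwise minimal: for all $s,t\in[0,1]$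 the map $f^{s,t}$ is a $C^k$ diffeomorphism and minimizes $\Phi_1$ over all $C^k$ diffeomorphisms $M^s\to M^t$. Then $t\mapsto \operatorname{Vol}(M^t)$ is positive and of class $C^1$ on $[0,1]$; for every $t\in[0,1]$ the infinitesimal distortion $$\varepsilon^F(t)=\lim_{s\to t}\frac{E^{s,t}}{(s-t)^2}$$ (with $s\in[0,1]$, $s\ne t$) exists and equals $\int_M \frac{\left(\frac{d}{dt}J(f^t)\right)^2}{J(f^t)}\,\omega_M$, where for every $p\in M$ the function $t\mapsto J(f^t)(p)$ is positive and differentiable on $[0,1]$ and the integrand is integrable on $M$; the function $\varepsilon^F$ is integrable on $[0,1]$; and the total distortion $\Psi(F)=\int_0^1\varepsilon^F(t)\,dt$ is $$\Psi(F)=\int_0^1\frac{\left(\frac{d}{dt}\operatorname{Vol}(M^t)\right)^2}{\operatorname{Vol}(M^t)}\,dt .$$ Derivatives at $t=0$ and $t=1$ are one-sided. -/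

import Mathlib

open Set Filter Topology MeasureTheory
open scoped ContDiff

namespace Morphing

/-- The ambient Euclidean space `ℝⁿ⁺¹`. -/
abbrev Ambient (n : ℕ) : Type := EuclideanSpace ℝ (Fin (n + 1))

variable {n : ℕ}

/-- The exterior of a set: the union of the unbounded connected components of its complement. -/
def exterior (M : Set (Ambient n)) : Set (Ambient n) :=
  {x | ¬ Bornology.IsBounded (connectedComponentIn Mᶜ x)}

/-- `v` is the outer unit normal of the hypersurface `M` at `p`: it is a unit vector, orthogonal to
the tangent space of `M` at `p`, it points to the exterior of `M`, and its opposite does not. -/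
structure IsOuterUnitNormal (M : Set (Ambient n)) (p v : Ambient n) : Prop where
  norm_eq_one : ‖v‖ = 1
  orthogonal : ∀ w ∈ tangentConeAt ℝ M p, inner ℝ v w = 0
  outward : ∀ᶠ δ : ℝ in 𝓝[>] 0, p + δ • v ∈ exterior M ∧ p - δ • v ∉ exterior M

/-- Compact connected smooth `n`-manifolds without boundary embedded in `ℝⁿ⁺¹`, oriented by their
outer unit normal field. Being an embedded smooth hypersurface is expressed by slice charts. -/
structure IsClosedHypersurface (M : Set (Ambient n)) : Prop where
  isCompact : IsCompact M
  isConnected : IsConnected M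
  exists_slice_chart : ∀ p ∈ M, ∃ Θ : OpenPartialHomeomorph (Ambient n)
      (EuclideanSpace ℝ (Fin n) × ℝ), p ∈ Θ.source ∧ ContDiffOn ℝ ∞ Θ Θ.source ∧
      ContDiffOn ℝ ∞ Θ.symm Θ.target ∧ ∀ q ∈ Θ.source, q ∈ M ↔ (Θ q).2 = 0
  oriented : ∃ η : Ambient n → Ambient n, ContinuousOn η M ∧
      ∀ p ∈ M, IsOuterUnitNormal M p (η p)

open Classical in
/-- The outer unit normal of `M` at `p` (there is at most one; the value is `0` if there is
none). -/
noncomputable def outerNormal (M : Set (Ambient n)) (p : Ambient n) : Ambient n :=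
  if h : ∃ v, IsOuterUnitNormal M p v then h.choose else 0

/-- The standard volume form `dx₁ ∧ ⋯ ∧ dxₙ₊₁` of the ambient space. -/
noncomputable def ambientForm (n : ℕ) : Ambient n [⋀^Fin (n + 1)]→ₗ[ℝ] ℝ :=
  (EuclideanSpace.basisFun (Fin (n + 1)) ℝ).toBasis.det

/-- The volume form of `M` at `p`: the interior product of the outer unit normal with the standard
volume form of the ambient space. It is meant to be evaluated on tangent vectors of `M` at `p`. -/
noncomputable def volumeForm (M : Set (Ambient n)) (p : Ambient n) :
    Ambient n [⋀^Fin n]→ₗ[ℝ] ℝ :=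
  (ambientForm n).curryLeft (outerNormal M p)

/-- The volume measure on a hypersurface `M`: the `n`-dimensional Hausdorff measure, normalized so
as to agree with Lebesgue measure on `ℝⁿ`, restricted to `M`. -/
noncomputable def volumeMeasure (M : Set (Ambient n)) : Measure (Ambient n) :=
  (Measure.euclideanHausdorffMeasure n).restrict M

/-- The volume of a hypersurface. -/
noncomputable def vol (M : Set (Ambient n)) : ℝ :=
  (volumeMeasure M).real univ

/-- `h` restricts to a `C^k` diffeomorphism from `M` onto `N`. (Only the values of `h` on `M`
matter. `ContDiffOn` on a subset that is not open is differentiability within the subset, which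
for an embedded submanifold is the same as being `C^k` in charts.) -/
def IsDiffeo (k : ℕ∞) (M N : Set (Ambient n)) (h : Ambient n → Ambient n) : Prop :=
  ContDiffOn ℝ k h M ∧ MapsTo h M N ∧
    ∃ g : Ambient n → Ambient n, ContDiffOn ℝ k g N ∧ MapsTo g N M ∧ InvOn g h M N

/-- The linear map that is the differential of `h` on the tangent space of `M` at `p` and sends the
outer unit normal of `M` at `p` to the outer unit normal of `N` at `h p`. -/
noncomputable def normalExtension (M N : Set (Ambient n)) (h : Ambient n → Ambient n)
    (p : Ambient n) : Ambient n →L[ℝ] Ambient n :=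
  (fderivWithin ℝ h M p).comp
      (ContinuousLinearMap.id ℝ (Ambient n) -
        (innerSL ℝ (outerNormal M p)).smulRight (outerNormal M p)) +
    (innerSL ℝ (outerNormal M p)).smulRight (outerNormal N (h p))

/-- The Jacobian `J(h)` of `h : M → N` with respect to the volume forms of `M` and `N`. The lemma
`volumeForm_pullback` states its defining property `h^* ω_N = J(h) ω_M`. -/
noncomputable def jacobian (M N : Set (Ambient n)) (h : Ambient n → Ambient n)
    (p : Ambient n) : ℝ :=
  (normalExtension M N h p).det

theorem outerNormal_spec {M : Set (Ambient n)} (hM : IsClosedHypersurface M) {p : Ambient n}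
    (hp : p ∈ M) : IsOuterUnitNormal M p (outerNormal M p) := by
  obtain ⟨η, -, hη⟩ := hM.oriented
  have h : ∃ v, IsOuterUnitNormal M p v := ⟨η p, hη p hp⟩
  rw [outerNormal, dif_pos h]
  exact h.choose_spec

/-- `h^* ω_N = J(h) ω_M` at every point of `M`. -/
theorem volumeForm_pullback {M : Set (Ambient n)} (hM : IsClosedHypersurface M)
    (N : Set (Ambient n)) (h : Ambient n → Ambient n) {p : Ambient n} (hp : p ∈ M)
    (v : Fin n → Ambient n) (hv : ∀ i, inner ℝ (outerNormal M p) (v i) = 0) :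
    volumeForm N (h p) (fun i => fderivWithin ℝ h M p (v i)) =
      jacobian M N h p * volumeForm M p v := by
  have h1 := (outerNormal_spec hM hp).norm_eq_one
  have key : (Matrix.vecCons (outerNormal N (h p)) fun i => fderivWithin ℝ h M p (v i)) =
      (normalExtension M N h p : Ambient n →ₗ[ℝ] Ambient n) ∘
        Matrix.vecCons (outerNormal M p) v := by
    funext i
    refine Fin.cases ?_ (fun j => ?_) i
    · simp [normalExtension, h1]
    · simp [normalExtension, hv]
  simp only [volumeForm, ambientForm, AlternatingMap.curryLeft_apply_apply, key]
  rw [Module.Basis.det_comp]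
  rfl

/-- The distortion energy `Φ₁(h) = ∫_M (|J(h)| - 1)² ω_M` of a diffeomorphism `h : M → N`. -/
noncomputable def stretchEnergy (M N : Set (Ambient n)) (h : Ambient n → Ambient n) : ℝ :=
  ∫ p, (|jacobian M N h p| - 1) ^ 2 ∂(volumeMeasure M)

/-- `F` is a `C^r` morph from `M` to `N` that starts at the identity map of `M`. Here `F t` stands
for the map `F(t, ·)`, and only its values on `M`, for `t ∈ [0, 1]`, matter. -/
structure IsMorph (r : ℕ∞) (M N : Set (Ambient n)) (F : ℝ → Ambient n → Ambient n) : Prop where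
  contDiffOn : ContDiffOn ℝ r (fun x : ℝ × Ambient n => F x.1 x.2) (Icc 0 1 ×ˢ M)
  isDiffeo : ∀ t ∈ Icc (0 : ℝ) 1, IsDiffeo r M (F t '' M) (F t)
  isClosedHypersurface : ∀ t ∈ Icc (0 : ℝ) 1, IsClosedHypersurface (F t '' M)
  start_eq : ∀ p ∈ M, F 0 p = p
  image_one : F 1 '' M = N

/-- The transition map `f^{s,t} = f^t ∘ (f^s)⁻¹` from `M^s = F(s, M)` to `M^t = F(t, M)`. -/
noncomputable def transition (M : Set (Ambient n)) (F : ℝ → Ambient n → Ambient n) (s t : ℝ) :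
    Ambient n → Ambient n :=
  F t ∘ Function.invFunOn (F s) M

/-- The distortion energy `E^{s,t} = Φ₁^{s,t}(f^{s,t})` of a transition map. -/
noncomputable def transitionEnergy (M : Set (Ambient n)) (F : ℝ → Ambient n → Ambient n)
    (s t : ℝ) : ℝ :=
  stretchEnergy (F s '' M) (F t '' M) (transition M F s t)

/-- `F` is distortion pairwise minimal: for all `s, t ∈ [0, 1]` the transition map `f^{s,t}`
minimizes the distortion energy over the set of all (`C^k`) diffeomorphisms from `M^s` to `M^t`. -/
def IsPairwiseMinimal (k : ℕ∞) (M : Set (Ambient n)) (F : ℝ → Ambient n → Ambient n) : Prop :=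
  ∀ s ∈ Icc (0 : ℝ) 1, ∀ t ∈ Icc (0 : ℝ) 1,
    IsDiffeo k (F s '' M) (F t '' M) (transition M F s t) ∧
    ∀ h : Ambient n → Ambient n, IsDiffeo k (F s '' M) (F t '' M) h →
      transitionEnergy M F s t ≤ stretchEnergy (F s '' M) (F t '' M) h

/-- The infinitesimal distortion `ε^F(t)`, the limit of `E^{s,t} / (s - t)²` as `s → t`. -/
noncomputable def infinitesimalDistortion (M : Set (Ambient n))
    (F : ℝ → Ambient n → Ambient n) (t : ℝ) : ℝ :=
  limUnder (𝓝[Icc 0 1 \ {t}] t) (fun s => transitionEnergy M F s t / (s - t) ^ 2)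

/-- The total distortion `Ψ(F) = ∫₀¹ ε^F(t) dt`. -/
noncomputable def totalDistortion (M : Set (Ambient n)) (F : ℝ → Ambient n → Ambient n) : ℝ :=
  ∫ t in (0 : ℝ)..1, infinitesimalDistortion M F t

/-- The Jacobian `J(f^t)` of `f^t : M → M^t` at `p`, as a function of `t`. -/
noncomputable def morphJacobian (M : Set (Ambient n)) (F : ℝ → Ambient n → Ambient n)
    (p : Ambient n) (t : ℝ) : ℝ :=
  jacobian M (F t '' M) (F t) p

end Morphing

/-! Let `f : M → N` be a minimizer between two hypersurfaces. Since `∫ |J(f)| = vol N` by change of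
variables, expanding the square turns the energy into `∫ |J(f)|² - 2 vol N + vol M`
(`IsDiffeo.stretchEnergy_eq`). Minimizing it therefore means minimizing `∫ |J(f)|²`. Precomposing
`f` with diffeomorphisms of `M` supported in a chart (`setIntegral_le_of_isMin`) and taking the
first variation shows that `|J(f)|²` has zero gradient in every chart (`fderiv_div_sq_eq_zero`). As
`M` is connected, `|J(f)|` is the constant `vol N / vol M`, and the minimal energy is `(vol N - vol
M)² / vol M` (`stretchEnergy_eq_of_isMin`).

For a pairwise minimal morph write `V(t) = vol (M^t)`. Then `E^{s,t} = (V(t) - V(s))² / V(s)`.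
Dividing by `(s - t)²` gives the square of a difference quotient of `V` over `V(s)`, with limit
`V'(t)² / V(t)` once `V` is known to be differentiable. The regularity of `V` also comes from the
constant Jacobian: `V(t) = |J(f^t)(p)| vol M` for one fixed `p`, and the right side is `C^1` in `t`
because the morph is `C^2` (`IsMorph.contDiffOn_vol`).

The formula in terms of `J(f^t)` needs the Jacobian with its sign. It equals `1` at `t = 0` and
never vanishes, so it stays positive provided it is continuous in `t`. Since the Jacobian involves
the outer normal, this requires that the outer normal of `M^t` at `f^t(p)` does not flip as `t`
moves (`IsMorph.tendsto_outerNormal`), which is the topological part of the argument. Then `J(f^t) =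
V(t) / vol M` pointwise, and the integrand is constant on `M`. -/

namespace Morphing

/-! ### Area formula for injective immersions. -/

section AreaFormula

/-- Second countability extracts a countable subcover; making it disjoint lets the local
inequalities be summed. -/
theorem measure_le_of_locally_le {X : Type*} [TopologicalSpace X] [SecondCountableTopology X]
    [MeasurableSpace X] [BorelSpace X] {μ ν : Measure X} {s : Set X}
    (h : ∀ x ∈ s, ∃ u, IsOpen u ∧ x ∈ u ∧ ∀ A, MeasurableSet A → A ⊆ s ∩ u → μ A ≤ ν A)
    {A : Set X} (hA : MeasurableSet A) (hAs : A ⊆ s) : μ A ≤ ν A := by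
  choose! u hu hxu hle using h
  obtain ⟨t, hts, htc, hcov⟩ := TopologicalSpace.countable_cover_nhdsWithin
    (fun x hx => mem_nhdsWithin_of_mem_nhds ((hu x hx).mem_nhds (hxu x hx)))
  rcases A.eq_empty_or_nonempty with rfl | ⟨a, ha⟩
  · simp
  have htn : t.Nonempty := by
    obtain ⟨x, hx, -⟩ := mem_iUnion₂.1 (hcov (hAs ha))
    exact ⟨x, hx⟩
  obtain ⟨f, rfl⟩ := htc.exists_eq_range htn
  have hf : ∀ i, f i ∈ s := fun i => hts (mem_range_self i)
  have hAe : A = ⋃ i, A ∩ disjointed (fun i => u (f i)) i := by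
    rw [← inter_iUnion, iUnion_disjointed]
    refine (inter_eq_left.2 fun x hx => ?_).symm
    simpa using hcov (hAs hx)
  have hm : ∀ i, MeasurableSet (A ∩ disjointed (fun i => u (f i)) i) := fun i =>
    hA.inter (MeasurableSet.disjointed (fun i => (hu _ (hf i)).measurableSet) i)
  have hd : Pairwise (Function.onFun Disjoint fun i => A ∩ disjointed (fun i => u (f i)) i) :=
    fun i j hij => (disjoint_disjointed _ hij).mono inter_subset_right inter_subset_right
  rw [hAe, measure_iUnion hd hm, measure_iUnion hd hm]
  refine ENNReal.tsum_le_tsum fun i => hle _ (hf i) _ (hm i) fun x hx => ⟨hAs hx.1, ?_⟩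
  exact disjointed_subset (fun i => u (f i)) i hx.2

/-- The hypothesis makes `f ∘ g⁻¹` a well-defined `K`-Lipschitz map on `g '' A`, even if `g` is not
injective: points with equal image under `g` have equal image under `f`. -/
theorem euclideanHausdorffMeasure_image_le_of_dist_le {α Y Z : Type*}
    [MetricSpace Y] [MeasurableSpace Y] [BorelSpace Y]
    [MetricSpace Z] [MeasurableSpace Z] [BorelSpace Z] {f : α → Y} {g : α → Z} {A : Set α}
    {K : NNReal} (h : ∀ x ∈ A, ∀ y ∈ A, dist (f x) (f y) ≤ K * dist (g x) (g y)) (d : ℕ) :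
    μHE[d] (f '' A) ≤ (K : ENNReal) ^ d * μHE[d] (g '' A) := by
  rcases A.eq_empty_or_nonempty with rfl | ⟨a, ha⟩
  · simp
  have : Nonempty α := ⟨a⟩
  let r : Z → Y := fun z => f (Function.invFunOn g A z)
  have hr : ∀ x ∈ A, r (g x) = f x := fun x hx => by
    have h1 := Function.invFunOn_mem (f := g) (s := A) ⟨x, hx, rfl⟩
    have h2 := Function.invFunOn_eq (f := g) (s := A) ⟨x, hx, rfl⟩
    have h3 := h _ h1 x hx
    rw [h2, dist_self, mul_zero] at h3
    exact dist_le_zero.1 h3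
  have himg : f '' A = r '' (g '' A) := by
    rw [image_image]
    exact image_congr fun x hx => (hr x hx).symm
  have hlip : LipschitzOnWith K r (g '' A) := by
    refine LipschitzOnWith.of_dist_le_mul ?_
    rintro _ ⟨x, hx, rfl⟩ _ ⟨y, hy, rfl⟩
    rw [hr x hx, hr y hy]
    exact h x hx y hy
  have := hlip.hausdorffMeasure_image_le (d := d) (Nat.cast_nonneg d)
  rw [himg]
  simp only [Measure.euclideanHausdorffMeasure_def, Measure.smul_apply]
  rw [ENNReal.smul_def, ENNReal.smul_def, smul_eq_mul, smul_eq_mul]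
  rw [ENNReal.rpow_natCast] at this
  calc _ ≤ _ := mul_le_mul_right this _
    _ = _ := by ring

variable {E V : Type*} [NormedAddCommGroup E] [InnerProductSpace ℝ E] [FiniteDimensional ℝ E]
  [NormedAddCommGroup V] [InnerProductSpace ℝ V]

theorem exists_dist_le_dist_of_hasStrictFDerivAt {φ : E → V} {L : E →L[ℝ] V} {x : E}
    (hφ : HasStrictFDerivAt φ L x) (hL : Function.Injective L) {c : ℝ} (hc : 1 < c) :
    ∃ u, IsOpen u ∧ x ∈ u ∧ ∀ y ∈ u, ∀ z ∈ u,
      dist (φ y) (φ z) ≤ c * dist (L y) (L z) ∧ dist (L y) (L z) ≤ c * dist (φ y) (φ z) := by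
  obtain ⟨K, hK, hanti⟩ := (L : E →ₗ[ℝ] V).exists_antilipschitzWith (LinearMap.ker_eq_bot.2 hL)
  have hK' : (0 : ℝ) < K := hK
  -- A relative error of `(c - 1) / c` serves both bounds: `1 - (c - 1) / c = 1 / c` and `1 + (c -
  -- 1) / c ≤ c`.
  have hδ : 0 < (c - 1) / c := div_pos (by linarith) (by linarith)
  have h1 := hφ.isLittleO.def (div_pos hδ hK')
  rw [nhds_prod_eq] at h1
  obtain ⟨t, ht, hts⟩ := (nhds_basis_opens x).prod_self.eventually_iff.1 h1
  refine ⟨t, ht.2, ht.1, fun y hy z hz => ?_⟩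
  have h2 := hts (mk_mem_prod hy hz)
  simp only at h2
  have h3 : ‖y - z‖ ≤ K * ‖L y - L z‖ := by
    have := hanti.le_mul_dist y z
    simpa [dist_eq_norm] using this
  have h4 : ‖φ y - φ z - L (y - z)‖ ≤ (c - 1) / c * ‖L y - L z‖ := by
    refine h2.trans ((mul_le_mul_of_nonneg_left h3 (div_pos hδ hK').le).trans_eq ?_)
    field_simp
  rw [map_sub] at h4
  rw [dist_eq_norm, dist_eq_norm]
  have h5 := norm_sub_norm_le (φ y - φ z) (L y - L z)
  have h6 := norm_sub_norm_le (L y - L z) (φ y - φ z)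
  rw [norm_sub_rev (L y - L z) (φ y - φ z)] at h6
  have h7 : (c - 1) / c * c = c - 1 := div_mul_cancel₀ _ (by linarith)
  have hn := norm_nonneg (L y - L z)
  have hle : (c - 1) / c ≤ c - 1 := div_le_self (by linarith) hc.le
  constructor
  · nlinarith
  · have : ‖L y - L z‖ - (c - 1) / c * ‖L y - L z‖ ≤ ‖φ y - φ z‖ := by linarith
    have h8 : c * (‖L y - L z‖ - (c - 1) / c * ‖L y - L z‖) = ‖L y - L z‖ := by
      linear_combination (-‖L y - L z‖) * h7
    rw [← h8]
    exact mul_le_mul_of_nonneg_left this (by linarith)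

theorem normDet_pos {L : E →L[ℝ] V} (hL : Function.Injective L) :
    0 < (L : E →ₗ[ℝ] V).normDet := by
  refine lt_of_le_of_ne (LinearMap.normDet_nonneg _) fun h => ?_
  exact LinearMap.normDet_eq_zero_iff_ker_ne_bot.1 h.symm (LinearMap.ker_eq_bot.2 hL)

/-- The square is a Gram determinant, hence polynomial in `L`. Smoothness of `normDet` itself then
holds where it is positive, that is, at injective maps. -/
theorem contDiff_normDet_sq {m : WithTop ℕ∞} :
    ContDiff ℝ m (fun L : E →L[ℝ] V => (L : E →ₗ[ℝ] V).normDet ^ 2) := by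
  have h : (fun L : E →L[ℝ] V => (L : E →ₗ[ℝ] V).normDet ^ 2) = fun L =>
      (Matrix.of fun i j => (inner ℝ (L (stdOrthonormalBasis ℝ E i)) (L (stdOrthonormalBasis ℝ E j)) : ℝ)).det := by
    funext L
    have := LinearMap.normDet_sq_eq_det_gram (L : E →ₗ[ℝ] V) (stdOrthonormalBasis ℝ E)
    simpa [Matrix.gram] using this
  rw [h]
  simp only [Matrix.det_apply', Matrix.of_apply]
  refine ContDiff.sum fun σ _ => ?_
  refine contDiff_const.mul (contDiff_prod fun i _ => ?_)
  exact ContDiff.inner ℝ (contDiff_id.clm_apply contDiff_const) (contDiff_id.clm_apply contDiff_const)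

theorem normDet_eq_sqrt (L : E →L[ℝ] V) :
    (L : E →ₗ[ℝ] V).normDet = √((L : E →ₗ[ℝ] V).normDet ^ 2) :=
  (Real.sqrt_sq (LinearMap.normDet_nonneg _)).symm

theorem continuous_normDet : Continuous (fun L : E →L[ℝ] V => (L : E →ₗ[ℝ] V).normDet) := by
  have : (fun L : E →L[ℝ] V => (L : E →ₗ[ℝ] V).normDet) = fun L : E →L[ℝ] V =>
      √((L : E →ₗ[ℝ] V).normDet ^ 2) := funext fun L => normDet_eq_sqrt L
  rw [this]
  exact Real.continuous_sqrt.comp (contDiff_normDet_sq (m := 0)).continuous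

theorem contDiffAt_normDet {m : WithTop ℕ∞} {L : E →L[ℝ] V} (hL : Function.Injective L) :
    ContDiffAt ℝ m (fun L : E →L[ℝ] V => (L : E →ₗ[ℝ] V).normDet) L := by
  have : (fun L : E →L[ℝ] V => (L : E →ₗ[ℝ] V).normDet) = fun L : E →L[ℝ] V =>
      √((L : E →ₗ[ℝ] V).normDet ^ 2) := funext fun L => normDet_eq_sqrt L
  rw [this]
  exact contDiff_normDet_sq.contDiffAt.sqrt (pow_pos (normDet_pos hL) 2).ne'

/-- An injective immersion of class `C^1` of the open set `U`. -/
structure IsImmersionOn (φ : E → V) (U : Set E) : Prop where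
  isOpen : IsOpen U
  contDiffOn : ContDiffOn ℝ 1 φ U
  injOn : InjOn φ U
  injective_fderiv : ∀ x ∈ U, Function.Injective (fderiv ℝ φ x)

variable {φ : E → V} {U : Set E}

theorem IsImmersionOn.continuousOn_normDet (h : IsImmersionOn φ U) :
    ContinuousOn (fun x => (fderiv ℝ φ x : E →ₗ[ℝ] V).normDet) U :=
  continuous_normDet.comp_continuousOn (h.contDiffOn.continuousOn_fderiv_of_isOpen h.isOpen le_rfl)

variable [MeasurableSpace E] [BorelSpace E]

theorem IsImmersionOn.aemeasurable_normDet (h : IsImmersionOn φ U) {A : Set E}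
    (hA : MeasurableSet A) (hAU : A ⊆ U) :
    AEMeasurable (fun x => (fderiv ℝ φ x : E →ₗ[ℝ] V).normDet) (volume.restrict A) :=
  (h.continuousOn_normDet.mono hAU).aemeasurable hA

variable [MeasurableSpace V] [BorelSpace V]

/-- **Area formula** for injective immersions. -/
theorem IsImmersionOn.euclideanHausdorffMeasure_image (h : IsImmersionOn φ U) {d : ℕ}
    (hd : Module.finrank ℝ E = d) {A : Set E} (hA : MeasurableSet A) (hAU : A ⊆ U) :
    μHE[d] (φ '' A) =
      ∫⁻ x in A, ENNReal.ofReal (fderiv ℝ φ x : E →ₗ[ℝ] V).normDet := by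
  subst hd
  have hUm := h.isOpen.measurableSet
  have hemb := h.contDiffOn.continuousOn.measurableEmbedding hUm h.injOn
  let ν : Measure E := ((μHE[Module.finrank ℝ E] : Measure V).comap (U.domRestrict φ)).map (↑)
  let κ : Measure E := volume.withDensity
    fun x => ENNReal.ofReal (fderiv ℝ φ x : E →ₗ[ℝ] V).normDet
  have hν : ∀ B, MeasurableSet B → B ⊆ U → ν B = μHE[Module.finrank ℝ E] (φ '' B) := by
    intro B hB hBU
    rw [Measure.map_apply measurable_subtype_coe hB, hemb.comap_apply]
    congr 1
    ext y
    constructor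
    · rintro ⟨⟨x, hx⟩, hxB, rfl⟩
      exact ⟨x, hxB, rfl⟩
    · rintro ⟨x, hx, rfl⟩
      exact ⟨⟨x, hBU hx⟩, hx, rfl⟩
  have hκ : ∀ B, MeasurableSet B →
      κ B = ∫⁻ x in B, ENNReal.ofReal (fderiv ℝ φ x : E →ₗ[ℝ] V).normDet :=
    fun B hB => withDensity_apply _ hB
  rw [← hν A hA hAU, ← hκ A hA]
  -- Near `x`, comparing `φ` with its derivative at `x` costs a factor `c` per dimension, and
  -- freezing the density at its value at `x` costs one more. The loss disappears as `c` decreases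
  -- to `1`.
  have key : ∀ c : NNReal, 1 < c → ∀ x ∈ U, ∃ u, IsOpen u ∧ x ∈ u ∧
      ∀ B, MeasurableSet B → B ⊆ U ∩ u →
        ν B ≤ (c : ENNReal) ^ (Module.finrank ℝ E + 1) * κ B ∧
        κ B ≤ (c : ENNReal) ^ (Module.finrank ℝ E + 1) * ν B := by
    intro c hc x hx
    have hxat := h.contDiffOn.contDiffAt (h.isOpen.mem_nhds hx)
    obtain ⟨u, huo, hxu, hu⟩ := exists_dist_le_dist_of_hasStrictFDerivAt
      (hxat.hasStrictFDerivAt one_ne_zero) (h.injective_fderiv x hx) (c := c) (by exact_mod_cast hc)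
    have hg := normDet_pos (h.injective_fderiv x hx)
    have hcont := h.continuousOn_normDet.continuousAt (h.isOpen.mem_nhds hx)
    set g := fun y => (fderiv ℝ φ y : E →ₗ[ℝ] V).normDet with hgdef
    have hc' : (1 : ℝ) < c := by exact_mod_cast hc
    have he1 : ∀ᶠ y in 𝓝 x, g x < c * g y :=
      (hcont.const_mul (c : ℝ)).eventually_const_lt (by nlinarith [hg])
    have he2 : ∀ᶠ y in 𝓝 x, g y < c * g x := hcont.eventually_lt_const (by nlinarith [hg])
    obtain ⟨w, hw, hwo, hxw⟩ := eventually_nhds_iff.1 (he1.and he2)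
    refine ⟨u ∩ w, huo.inter hwo, ⟨hxu, hxw⟩, fun B hB hBU => ?_⟩
    have hlin := LinearMap.euclideanHausdorffMeasure_image_eq_normDet_mul_volume
      (fderiv ℝ φ x : E →ₗ[ℝ] V) B
    have hb1 := euclideanHausdorffMeasure_image_le_of_dist_le (A := B) (f := φ)
      (g := fderiv ℝ φ x) (K := c) (fun y hy z hz => (hu y (hBU hy).2.1 z (hBU hz).2.1).1)
      (Module.finrank ℝ E)
    have hb2 := euclideanHausdorffMeasure_image_le_of_dist_le (A := B) (g := φ)
      (f := fderiv ℝ φ x) (K := c) (fun y hy z hz => (hu y (hBU hy).2.1 z (hBU hz).2.1).2)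
      (Module.finrank ℝ E)
    rw [hν B hB (fun y hy => (hBU hy).1), hκ B hB]
    have hcof : ENNReal.ofReal (c : ℝ) = c := ENNReal.ofReal_coe_nnreal
    have hi1 : ENNReal.ofReal (g x) * volume B ≤ c * ∫⁻ y in B, ENNReal.ofReal (g y) := by
      rw [← setLIntegral_const, ← lintegral_const_mul' _ _ ENNReal.coe_ne_top]
      refine setLIntegral_mono' hB fun y hy => ?_
      rw [← hcof, ← ENNReal.ofReal_mul c.coe_nonneg]
      exact ENNReal.ofReal_le_ofReal (hw y (hBU hy).2.2).1.le
    have hi2 : ∫⁻ y in B, ENNReal.ofReal (g y) ≤ c * (ENNReal.ofReal (g x) * volume B) := by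
      rw [← setLIntegral_const, ← lintegral_const_mul' _ _ ENNReal.coe_ne_top]
      refine setLIntegral_mono' hB fun y hy => ?_
      rw [← hcof, ← ENNReal.ofReal_mul c.coe_nonneg]
      exact ENNReal.ofReal_le_ofReal (hw y (hBU hy).2.2).2.le
    have hlin' : μHE[Module.finrank ℝ E] (fderiv ℝ φ x '' B) = ENNReal.ofReal (g x) * volume B :=
      hlin
    rw [hlin'] at hb1 hb2
    constructor
    · refine hb1.trans ?_
      rw [pow_succ, mul_assoc]
      gcongr
    · refine hi2.trans ?_
      rw [pow_succ', mul_assoc]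
      gcongr
  have lim : ∀ a b : ENNReal, (∀ c : NNReal, 1 < c →
      a ≤ (c : ENNReal) ^ (Module.finrank ℝ E + 1) * b) → a ≤ b := by
    intro a b hab
    have ht : Tendsto (fun c : NNReal => (c : ENNReal) ^ (Module.finrank ℝ E + 1) * b)
        (𝓝[>] 1) (𝓝 ((1 : NNReal) ^ (Module.finrank ℝ E + 1) * b)) := by
      refine ENNReal.Tendsto.mul_const ?_ (Or.inl (by simp))
      refine ((ENNReal.continuous_pow _).tendsto _).comp ?_
      exact (ENNReal.continuous_coe.tendsto _).mono_left nhdsWithin_le_nhds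
    rw [show ((1 : NNReal) : ENNReal) ^ (Module.finrank ℝ E + 1) * b = b by simp] at ht
    exact ge_of_tendsto ht (by filter_upwards [self_mem_nhdsWithin] with c hc using hab c hc)
  refine le_antisymm (lim _ _ fun c hc => ?_) (lim _ _ fun c hc => ?_)
  · refine measure_le_of_locally_le (ν := (c : ENNReal) ^ (Module.finrank ℝ E + 1) • κ)
      (s := U) (fun x hx => ?_) hA hAU
    obtain ⟨u, huo, hxu, hu⟩ := key c hc x hx
    exact ⟨u, huo, hxu, fun B hB hBU => (hu B hB hBU).1⟩
  · refine measure_le_of_locally_le (ν := (c : ENNReal) ^ (Module.finrank ℝ E + 1) • ν)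
      (s := U) (fun x hx => ?_) hA hAU
    obtain ⟨u, huo, hxu, hu⟩ := key c hc x hx
    exact ⟨u, huo, hxu, fun B hB hBU => (hu B hB hBU).2⟩

theorem IsImmersionOn.measurableEmbedding (h : IsImmersionOn φ U) {A : Set E}
    (hA : MeasurableSet A) (hAU : A ⊆ U) : MeasurableEmbedding (A.domRestrict φ) :=
  (h.contDiffOn.continuousOn.mono hAU).measurableEmbedding hA (h.injOn.mono hAU)

/-- The area formula as an identity of measures. Because the push-forward is along a measurable
embedding, integrals of arbitrary functions can be transported without measurability hypotheses. -/
theorem IsImmersionOn.map_withDensity_normDet (h : IsImmersionOn φ U) {d : ℕ}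
    (hd : Module.finrank ℝ E = d) {A : Set E} (hA : MeasurableSet A) (hAU : A ⊆ U) :
    Measure.map (A.domRestrict φ) (Measure.comap (↑) (volume.withDensity fun x =>
      ENNReal.ofReal (fderiv ℝ φ x : E →ₗ[ℝ] V).normDet)) =
      (μHE[d] : Measure V).restrict (φ '' A) := by
  have hemb := h.measurableEmbedding hA hAU
  refine Measure.ext fun B hB => ?_
  have h1 : (Subtype.val '' (A.domRestrict φ ⁻¹' B)) = A ∩ φ ⁻¹' B := by
    ext x
    simp [and_comm]
  have hBA : MeasurableSet (A ∩ φ ⁻¹' B) := by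
    rw [← h1]
    exact (MeasurableEmbedding.subtype_coe hA).measurableSet_image.2 (hemb.measurable hB)
  rw [hemb.map_apply, (MeasurableEmbedding.subtype_coe hA).comap_apply,
    Measure.restrict_apply hB]
  have h2 : B ∩ φ '' A = φ '' (A ∩ φ ⁻¹' B) := by
    rw [image_inter_preimage, inter_comm]
  rw [h1, h2, withDensity_apply _ hBA,
    h.euclideanHausdorffMeasure_image hd hBA (inter_subset_left.trans hAU)]

/-- Change of variables along an injective immersion. -/
theorem IsImmersionOn.setIntegral_image (h : IsImmersionOn φ U) {d : ℕ}
    (hd : Module.finrank ℝ E = d) {A : Set E} (hA : MeasurableSet A) (hAU : A ⊆ U) (f : V → ℝ) :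
    ∫ q in φ '' A, f q ∂μHE[d] =
      ∫ x in A, (fderiv ℝ φ x : E →ₗ[ℝ] V).normDet * f (φ x) := by
  rw [← h.map_withDensity_normDet hd hA hAU, (h.measurableEmbedding hA hAU).integral_map]
  simp only [Set.domRestrict_apply, ENNReal.ofReal]
  rw [← (MeasurableEmbedding.subtype_coe hA).integral_map
      (g := fun x => f (φ x)), map_comap_subtype_coe hA,
    setIntegral_withDensity_eq_setIntegral_smul₀
      (h.aemeasurable_normDet hA hAU).real_toNNReal _ hA]
  refine integral_congr_ae (Eventually.of_forall fun x => ?_)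
  simp only [NNReal.smul_def, Real.coe_toNNReal _ (LinearMap.normDet_nonneg _), smul_eq_mul]

/-- Change of variables along an injective immersion. -/
theorem IsImmersionOn.setLIntegral_image (h : IsImmersionOn φ U) {d : ℕ}
    (hd : Module.finrank ℝ E = d) {A : Set E} (hA : MeasurableSet A) (hAU : A ⊆ U)
    (f : V → ENNReal) :
    ∫⁻ q in φ '' A, f q ∂μHE[d] =
      ∫⁻ x in A, ENNReal.ofReal (fderiv ℝ φ x : E →ₗ[ℝ] V).normDet * f (φ x) := by
  rw [← h.map_withDensity_normDet hd hA hAU, (h.measurableEmbedding hA hAU).lintegral_map]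
  simp only [Set.domRestrict_apply]
  rw [← (MeasurableEmbedding.subtype_coe hA).lintegral_map
      (f := fun x => f (φ x)), map_comap_subtype_coe hA,
    setLIntegral_withDensity_eq_setLIntegral_mul_non_measurable₀ _
      (h.aemeasurable_normDet hA hAU).ennreal_ofReal _ hA
      (Eventually.of_forall fun x => ENNReal.ofReal_lt_top)]
  rfl

end AreaFormula

end Morphing

/-! ### Charts of hypersurfaces and the Jacobian in charts. -/

namespace Morphing

/-- The model space `ℝⁿ`. -/
abbrev Model (n : ℕ) : Type := EuclideanSpace ℝ (Fin n)

variable {n : ℕ}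

/-- `φ` parametrizes, diffeomorphically with inverse `π`, a part of `M` by the open set `U`. -/
structure IsParam (k : WithTop ℕ∞) (M : Set (Ambient n)) (φ : Model n → Ambient n)
    (π : Ambient n → Model n) (U : Set (Model n)) : Prop where
  isOpen : IsOpen U
  contDiffOn : ContDiffOn ℝ k φ U
  mapsTo : MapsTo φ U M
  contDiffOn_inv : ContDiffOn ℝ k π (φ '' U)
  left_inv : ∀ x ∈ U, π (φ x) = x

/-- A smooth parametrization of a relatively open subset of `M`. -/
structure IsChart (M : Set (Ambient n)) (φ : Model n → Ambient n)
    (π : Ambient n → Model n) (U : Set (Model n)) : Prop extends IsParam ∞ M φ π U where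
  exists_isOpen : ∃ W, IsOpen W ∧ φ '' U = M ∩ W

variable {M N : Set (Ambient n)} {φ : Model n → Ambient n} {π : Ambient n → Model n}
  {U : Set (Model n)} {k : WithTop ℕ∞}

theorem IsParam.injOn (h : IsParam k M φ π U) : InjOn φ U :=
  LeftInvOn.injOn (f₁' := π) h.left_inv

theorem IsParam.of_le {m : WithTop ℕ∞} (h : IsParam k M φ π U) (hm : m ≤ k) :
    IsParam m M φ π U :=
  ⟨h.isOpen, h.contDiffOn.of_le hm, h.mapsTo, h.contDiffOn_inv.of_le hm, h.left_inv⟩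

theorem IsParam.differentiableAt (h : IsParam k M φ π U) (hk : 1 ≤ k) {x : Model n} (hx : x ∈ U) :
    DifferentiableAt ℝ φ x :=
  (h.contDiffOn.contDiffAt (h.isOpen.mem_nhds hx)).differentiableAt
    (fun h0 => by simp [h0] at hk)

/-- Differentiating `π ∘ φ = id` gives a left inverse of the differential; `π` need only be
differentiable within the image. -/
theorem IsParam.isImmersionOn (h : IsParam k M φ π U) (hk : 1 ≤ k) : IsImmersionOn φ U where
  isOpen := h.isOpen
  contDiffOn := h.contDiffOn.of_le hk
  injOn := h.injOn
  injective_fderiv x hx := by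
    have h1 := (h.differentiableAt hk hx).hasFDerivAt
    have h2 := ((h.contDiffOn_inv.of_le hk).differentiableOn one_ne_zero _
      (mem_image_of_mem φ hx)).hasFDerivWithinAt
    have hev : ∀ᶠ y in 𝓝 x, y ∈ U := h.isOpen.mem_nhds hx
    have h3 := h2.comp_hasFDerivAt x h1 (hev.mono fun y hy => mem_image_of_mem φ hy)
    have h4 : HasFDerivAt (π ∘ φ) (ContinuousLinearMap.id ℝ (Model n)) x :=
      (hasFDerivAt_id x).congr_of_eventuallyEq (hev.mono fun y hy => h.left_inv y hy)
    have h5 := h3.unique h4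
    refine Function.LeftInverse.injective (g := fderivWithin ℝ π (φ '' U) (φ x)) fun v => ?_
    exact congrArg (fun T : Model n →L[ℝ] Model n => T v) h5

theorem IsParam.comp_diffeo {r : ℕ∞} (h : IsParam r M φ π U) {f g : Ambient n → Ambient n}
    (hf : ContDiffOn ℝ r f M) (hfm : MapsTo f M N) (hg : ContDiffOn ℝ r g N)
    (hgf : LeftInvOn g f M) :
    IsParam r N (f ∘ φ) (π ∘ g) U where
  isOpen := h.isOpen
  contDiffOn := hf.comp h.contDiffOn h.mapsTo
  mapsTo := hfm.comp h.mapsTo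
  contDiffOn_inv := by
    refine h.contDiffOn_inv.comp (hg.mono ?_) ?_
    · rintro _ ⟨x, hx, rfl⟩
      exact hfm (h.mapsTo hx)
    · rintro _ ⟨x, hx, rfl⟩
      exact ⟨x, hx, (hgf (h.mapsTo hx)).symm⟩
  left_inv x hx := by
    simp only [Function.comp_apply, hgf (h.mapsTo hx), h.left_inv x hx]

theorem IsDiffeo.isParam_comp {r : ℕ∞} (h : IsParam r M φ π U) {f : Ambient n → Ambient n}
    (hf : IsDiffeo r M N f) : ∃ ρ, IsParam r N (f ∘ φ) ρ U := by
  obtain ⟨h1, h2, g, h3, -, h5⟩ := hf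
  exact ⟨_, h.comp_diffeo h1 h2 h3 h5.1⟩

theorem IsChart.restrict (h : IsChart M φ π U) {B : Set (Model n)} (hB : IsOpen B) (hBU : B ⊆ U) :
    IsChart M φ π B where
  isOpen := hB
  contDiffOn := h.contDiffOn.mono hBU
  mapsTo := h.mapsTo.mono_left hBU
  contDiffOn_inv := h.contDiffOn_inv.mono (image_mono hBU)
  left_inv x hx := h.left_inv x (hBU hx)
  exists_isOpen := by
    obtain ⟨W, hW, hUW⟩ := h.exists_isOpen
    obtain ⟨O, hO, hOe⟩ := (continuousOn_iff'.1 h.contDiffOn_inv.continuousOn) B hB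
    refine ⟨O ∩ W, hO.inter hW, ?_⟩
    have : φ '' B = π ⁻¹' B ∩ φ '' U := by
      ext q
      constructor
      · rintro ⟨x, hx, rfl⟩
        refine ⟨?_, x, hBU hx, rfl⟩
        rw [mem_preimage, h.left_inv x (hBU hx)]
        exact hx
      · rintro ⟨h1, x, hx, rfl⟩
        rw [mem_preimage, h.left_inv x hx] at h1
        exact ⟨x, h1, rfl⟩
    rw [this, hOe, hUW]
    ext q
    simp only [mem_inter_iff]
    tauto

/-- A slice chart restricted to the hyperplane where the last coordinate vanishes. -/
theorem IsClosedHypersurface.exists_isChart (hM : IsClosedHypersurface M) {p : Ambient n}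
    (hp : p ∈ M) : ∃ φ π U x, IsChart M φ π U ∧ x ∈ U ∧ φ x = p := by
  obtain ⟨Θ, hpΘ, hΘ, hΘs, hs⟩ := hM.exists_slice_chart p hp
  let φ : Model n → Ambient n := fun x => Θ.symm (x, 0)
  let π : Ambient n → Model n := fun q => (Θ q).1
  let U : Set (Model n) := {x | (x, (0 : ℝ)) ∈ Θ.target}
  have hle : ∀ x ∈ U, Θ (φ x) = (x, 0) := fun x hx => Θ.right_inv hx
  have hsrc : ∀ x ∈ U, φ x ∈ Θ.source := fun x hx => Θ.map_target hx
  have hmem : ∀ q ∈ M ∩ Θ.source, (π q, (0 : ℝ)) = Θ q := fun q hq =>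
    Prod.ext rfl ((hs q hq.2).1 hq.1).symm
  have himg : φ '' U = M ∩ Θ.source := by
    ext q
    constructor
    · rintro ⟨x, hx, rfl⟩
      refine ⟨(hs _ (hsrc x hx)).2 ?_, hsrc x hx⟩
      rw [hle x hx]
    · intro hq
      refine ⟨π q, ?_, ?_⟩
      · change (π q, (0 : ℝ)) ∈ Θ.target
        rw [hmem q hq]
        exact Θ.map_source hq.2
      · change Θ.symm (π q, (0 : ℝ)) = q
        rw [hmem q hq]
        exact Θ.left_inv hq.2
  refine ⟨φ, π, U, π p, ⟨⟨?_, ?_, ?_, ?_, ?_⟩, Θ.source, Θ.open_source, himg⟩, ?_, ?_⟩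
  · exact Θ.open_target.preimage (by fun_prop : Continuous fun x : Model n => (x, (0 : ℝ)))
  · exact hΘs.comp (by fun_prop : ContDiff ℝ ∞ fun x : Model n => (x, (0 : ℝ))).contDiffOn
      fun x hx => hx
  · exact fun x hx => (himg.subset (mem_image_of_mem φ hx)).1
  · rw [himg]
    exact (contDiff_fst.comp_contDiffOn hΘ).mono inter_subset_right
  · exact fun x hx => congrArg Prod.fst (hle x hx)
  · change (π p, (0 : ℝ)) ∈ Θ.target
    rw [hmem p ⟨hp, hpΘ⟩]
    exact Θ.map_source hpΘ
  · change Θ.symm (π p, (0 : ℝ)) = p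
    rw [hmem p ⟨hp, hpΘ⟩]
    exact Θ.left_inv hpΘ

theorem fderiv_mem_tangentConeAt (hU : IsOpen U) (hφ : MapsTo φ U M) {x : Model n} (hx : x ∈ U)
    (hd : DifferentiableAt ℝ φ x) (v : Model n) : fderiv ℝ φ x v ∈ tangentConeAt ℝ M (φ x) := by
  have h := HasFDerivWithinAt.mapsTo_tangent_cone (hd.hasFDerivAt.hasFDerivWithinAt (s := U))
  refine tangentConeAt_mono hφ.image_subset (h ?_)
  rw [tangentConeAt_of_mem_nhds (hU.mem_nhds hx)]
  trivial

theorem inner_outerNormal_fderiv (hM : IsClosedHypersurface M) (hU : IsOpen U)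
    (hφ : MapsTo φ U M) {x : Model n} (hx : x ∈ U) (hd : DifferentiableAt ℝ φ x) (v : Model n) :
    inner ℝ (outerNormal M (φ x)) (fderiv ℝ φ x v) = 0 :=
  (outerNormal_spec hM (hφ hx)).orthogonal _ (fderiv_mem_tangentConeAt hU hφ hx hd v)

/-- The images of the standard basis vectors under a linear map. -/
noncomputable def frame (L : Model n →L[ℝ] Ambient n) : Fin n → Ambient n :=
  fun i => L (EuclideanSpace.basisFun (Fin n) ℝ i)

theorem ambientForm_sq_eq_det_gram (v : Fin (n + 1) → Ambient n) :
    ambientForm n v ^ 2 = (Matrix.of fun i j => (inner ℝ (v i) (v j) : ℝ)).det := by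
  have h : (Matrix.of fun i j => (inner ℝ (v i) (v j) : ℝ)) =
      ((EuclideanSpace.basisFun (Fin (n + 1)) ℝ).toBasis.toMatrix v).transpose *
        (EuclideanSpace.basisFun (Fin (n + 1)) ℝ).toBasis.toMatrix v := by
    ext i j
    simp [Matrix.mul_apply, Module.Basis.toMatrix_apply, PiLp.inner_apply, mul_comm]
  rw [h, Matrix.det_mul, Matrix.det_transpose, ambientForm, Module.Basis.det_apply, sq]

/-- A unit vector orthogonal to the frame contributes a diagonal block `1` to the Gram matrix. This
identifies the volume form, up to sign, with the density of the area formula. -/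
theorem ambientForm_cons_frame_sq {ν : Ambient n} (hν : ‖ν‖ = 1) {L : Model n →L[ℝ] Ambient n}
    (hL : ∀ v, inner ℝ ν (L v) = 0) :
    ambientForm n (Matrix.vecCons ν (frame L)) ^ 2 =
      (L : Model n →ₗ[ℝ] Ambient n).normDet ^ 2 := by
  have h1 := LinearMap.normDet_sq_eq_det_gram (L : Model n →ₗ[ℝ] Ambient n)
    (EuclideanSpace.basisFun (Fin n) ℝ)
  have h1' : (L : Model n →ₗ[ℝ] Ambient n).normDet ^ 2 =
      (Matrix.of fun i j => (inner ℝ (frame L i) (frame L j) : ℝ)).det := by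
    simpa [Matrix.gram, frame] using h1
  rw [ambientForm_sq_eq_det_gram, h1', Matrix.det_succ_row_zero, Fin.sum_univ_succ]
  have h0 : ∀ i : Fin n, inner ℝ ν (frame L i) = 0 := fun i => hL _
  simp [h0, hν]
  rfl

theorem volumeForm_frame_abs (hM : IsClosedHypersurface M) {p : Ambient n} (hp : p ∈ M)
    {L : Model n →L[ℝ] Ambient n} (hL : ∀ v, inner ℝ (outerNormal M p) (L v) = 0) :
    |volumeForm M p (frame L)| = (L : Model n →ₗ[ℝ] Ambient n).normDet := by
  have h := ambientForm_cons_frame_sq (outerNormal_spec hM hp).norm_eq_one hL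
  rw [sq_eq_sq_iff_abs_eq_abs, abs_of_nonneg (LinearMap.normDet_nonneg _)] at h
  exact h

theorem volumeForm_frame_comp (hM : IsClosedHypersurface M) {f : Ambient n → Ambient n}
    (hU : IsOpen U) (hφ : MapsTo φ U M) {x : Model n} (hx : x ∈ U) (hd : DifferentiableAt ℝ φ x)
    (hf : DifferentiableWithinAt ℝ f M (φ x)) :
    volumeForm N (f (φ x)) (frame (fderiv ℝ (f ∘ φ) x)) =
      jacobian M N f (φ x) * volumeForm M (φ x) (frame (fderiv ℝ φ x)) := by
  have h := hf.hasFDerivWithinAt.comp_hasFDerivAt x hd.hasFDerivAt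
    (by filter_upwards [hU.mem_nhds hx] with y hy using hφ hy)
  rw [h.fderiv]
  exact volumeForm_pullback hM N f (hφ hx) (frame (fderiv ℝ φ x))
    fun i => inner_outerNormal_fderiv hM hU hφ hx hd _

/-- The absolute value of `volumeForm_pullback`. It expresses `|J(f)|` as a ratio of densities in
which no normal field appears, so its regularity can be read off in charts. -/
theorem normDet_fderiv_comp (hM : IsClosedHypersurface M) (hN : IsClosedHypersurface N)
    {f : Ambient n → Ambient n} (hU : IsOpen U) (hφ : MapsTo φ U M) (hfm : MapsTo f M N)
    {x : Model n} (hx : x ∈ U) (hd : DifferentiableAt ℝ φ x)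
    (hf : DifferentiableWithinAt ℝ f M (φ x)) :
    (fderiv ℝ (f ∘ φ) x : Model n →ₗ[ℝ] Ambient n).normDet =
      |jacobian M N f (φ x)| * (fderiv ℝ φ x : Model n →ₗ[ℝ] Ambient n).normDet := by
  have hd' : DifferentiableAt ℝ (f ∘ φ) x :=
    (hf.hasFDerivWithinAt.comp_hasFDerivAt x hd.hasFDerivAt
      (by filter_upwards [hU.mem_nhds hx] with y hy using hφ hy)).differentiableAt
  rw [← volumeForm_frame_abs hM (hφ hx) (inner_outerNormal_fderiv hM hU hφ hx hd), ← abs_mul,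
    ← volumeForm_frame_comp hM hU hφ hx hd hf]
  exact (volumeForm_frame_abs hN (hfm (hφ hx))
    (inner_outerNormal_fderiv hN hU (hfm.comp hφ) hx hd')).symm

end Morphing

/-! ### Finiteness and positivity of volume, change of variables, expansion of the energy. -/

namespace Morphing

variable {n : ℕ} {M N : Set (Ambient n)} {φ : Model n → Ambient n} {π : Ambient n → Model n}
  {U : Set (Model n)} {f : Ambient n → Ambient n}

theorem two_le_infty : (2 : WithTop ℕ∞) ≤ ∞ :=
  WithTop.coe_le_coe.2 (le_top : (2 : ℕ∞) ≤ ⊤)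

theorem IsChart.isImmersionOn (h : IsChart M φ π U) : IsImmersionOn φ U :=
  h.toIsParam.isImmersionOn (by exact_mod_cast le_top)

theorem IsChart.differentiableAt (h : IsChart M φ π U) {x : Model n} (hx : x ∈ U) :
    DifferentiableAt ℝ φ x :=
  h.toIsParam.differentiableAt (by exact_mod_cast le_top) hx

theorem IsChart.normDet_pos (h : IsChart M φ π U) {x : Model n} (hx : x ∈ U) :
    0 < (fderiv ℝ φ x : Model n →ₗ[ℝ] Ambient n).normDet :=
  Morphing.normDet_pos (h.isImmersionOn.injective_fderiv x hx)

theorem IsChart.image_mem_nhdsWithin (h : IsChart M φ π U) {x : Model n} (hx : x ∈ U) :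
    φ '' U ∈ 𝓝[M] (φ x) := by
  obtain ⟨W, hW, hUW⟩ := h.exists_isOpen
  rw [hUW]
  exact inter_mem_nhdsWithin _ (hW.mem_nhds (hUW.subset (mem_image_of_mem φ hx)).2)

theorem IsDiffeo.of_le {r s : ℕ∞} (h : IsDiffeo r M N f) (hs : s ≤ r) : IsDiffeo s M N f := by
  obtain ⟨h1, h2, g, h3, h4, h5⟩ := h
  have hs' : (s : WithTop ℕ∞) ≤ r := by exact_mod_cast hs
  exact ⟨h1.of_le hs', h2, g, h3.of_le hs', h4, h5⟩

theorem IsDiffeo.image_eq {r : ℕ∞} (h : IsDiffeo r M N f) : f '' M = N := by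
  obtain ⟨-, h2, g, -, h4, h5⟩ := h
  exact (h5.bijOn h2 h4).image_eq

theorem IsDiffeo.injOn {r : ℕ∞} (h : IsDiffeo r M N f) : InjOn f M := by
  obtain ⟨-, h2, g, -, h4, h5⟩ := h
  exact (h5.bijOn h2 h4).injOn

theorem IsDiffeo.differentiableWithinAt (h : IsDiffeo 1 M N f) {p : Ambient n} (hp : p ∈ M) :
    DifferentiableWithinAt ℝ f M p :=
  h.1.differentiableOn one_ne_zero p hp

theorem IsDiffeo.isImmersionOn_comp (h : IsDiffeo 1 M N f) (hφ : IsChart M φ π U) :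
    IsImmersionOn (f ∘ φ) U := by
  obtain ⟨ρ, hρ⟩ := h.isParam_comp (r := 1) (hφ.toIsParam.of_le (by exact_mod_cast le_top))
  exact hρ.isImmersionOn le_rfl

theorem IsDiffeo.normDet_fderiv_comp (h : IsDiffeo 1 M N f) (hM : IsClosedHypersurface M)
    (hN : IsClosedHypersurface N) (hφ : IsChart M φ π U) {x : Model n} (hx : x ∈ U) :
    (fderiv ℝ (f ∘ φ) x : Model n →ₗ[ℝ] Ambient n).normDet =
      |jacobian M N f (φ x)| * (fderiv ℝ φ x : Model n →ₗ[ℝ] Ambient n).normDet :=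
  Morphing.normDet_fderiv_comp hM hN hφ.isOpen hφ.mapsTo h.2.1 hx (hφ.differentiableAt hx)
    (h.differentiableWithinAt (hφ.mapsTo hx))

theorem IsDiffeo.abs_jacobian_eq_div (h : IsDiffeo 1 M N f) (hM : IsClosedHypersurface M)
    (hN : IsClosedHypersurface N) (hφ : IsChart M φ π U) {x : Model n} (hx : x ∈ U) :
    |jacobian M N f (φ x)| = (fderiv ℝ (f ∘ φ) x : Model n →ₗ[ℝ] Ambient n).normDet /
      (fderiv ℝ φ x : Model n →ₗ[ℝ] Ambient n).normDet := by
  rw [h.normDet_fderiv_comp hM hN hφ hx, mul_div_cancel_right₀ _ (hφ.normDet_pos hx).ne']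

theorem IsDiffeo.abs_jacobian_pos (h : IsDiffeo 1 M N f) (hM : IsClosedHypersurface M)
    (hN : IsClosedHypersurface N) {p : Ambient n} (hp : p ∈ M) : 0 < |jacobian M N f p| := by
  obtain ⟨φ, π, U, x, hφ, hx, rfl⟩ := hM.exists_isChart hp
  rw [h.abs_jacobian_eq_div hM hN hφ hx]
  exact div_pos (Morphing.normDet_pos ((h.isImmersionOn_comp hφ).injective_fderiv x hx))
    (hφ.normDet_pos hx)

/-- In a chart this is a quotient of continuous densities, the denominator being positive;
continuity of the chosen normals is not needed. -/
theorem IsDiffeo.continuousOn_abs_jacobian (h : IsDiffeo 1 M N f) (hM : IsClosedHypersurface M)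
    (hN : IsClosedHypersurface N) : ContinuousOn (fun p => |jacobian M N f p|) M := by
  intro p hp
  obtain ⟨φ, π, U, x, hφ, hx, rfl⟩ := hM.exists_isChart hp
  have h1 : ContinuousOn (fun y => (fderiv ℝ (f ∘ φ) y : Model n →ₗ[ℝ] Ambient n).normDet /
      (fderiv ℝ φ y : Model n →ₗ[ℝ] Ambient n).normDet) U :=
    (h.isImmersionOn_comp hφ).continuousOn_normDet.div hφ.isImmersionOn.continuousOn_normDet
      fun y hy => (hφ.normDet_pos hy).ne'
  have h2 : MapsTo π (φ '' U) U := by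
    rintro _ ⟨y, hy, rfl⟩
    rwa [hφ.left_inv y hy]
  have h3 := h1.comp hφ.contDiffOn_inv.continuousOn h2
  have h4 : ContinuousOn (fun p => |jacobian M N f p|) (φ '' U) := by
    refine h3.congr ?_
    rintro _ ⟨y, hy, rfl⟩
    simp only [Function.comp_apply, hφ.left_inv y hy]
    exact h.abs_jacobian_eq_div hM hN hφ hy
  exact (h4 _ (mem_image_of_mem φ hx)).mono_of_mem_nhdsWithin (hφ.image_mem_nhdsWithin hx)

theorem IsClosedHypersurface.measurableSet (hM : IsClosedHypersurface M) : MeasurableSet M :=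
  hM.isCompact.isClosed.measurableSet

theorem IsClosedHypersurface.measure_lt_top (hM : IsClosedHypersurface M) :
    (μHE[n] : Measure (Ambient n)) M < ⊤ := by
  refine hM.isCompact.measure_lt_top_of_nhdsWithin fun p hp => ?_
  obtain ⟨φ, π, U, x, hφ, hx, rfl⟩ := hM.exists_isChart hp
  obtain ⟨r, hr, hrU⟩ := Metric.nhds_basis_closedBall.mem_iff.1 (hφ.isOpen.mem_nhds hx)
  have hball := hφ.restrict Metric.isOpen_ball (Metric.ball_subset_closedBall.trans hrU)
  refine ⟨_, hball.image_mem_nhdsWithin (Metric.mem_ball_self hr), ?_⟩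
  rw [hφ.isImmersionOn.euclideanHausdorffMeasure_image (by simp) measurableSet_ball
    (Metric.ball_subset_closedBall.trans hrU)]
  refine (lintegral_mono_set Metric.ball_subset_closedBall).trans_lt ?_
  have := (hφ.isImmersionOn.continuousOn_normDet.mono hrU).integrableOn_compact (μ := volume)
    (isCompact_closedBall x r)
  exact this.lintegral_lt_top

theorem IsClosedHypersurface.isFiniteMeasure (hM : IsClosedHypersurface M) :
    IsFiniteMeasure (volumeMeasure M) :=
  ⟨by rw [volumeMeasure, Measure.restrict_apply_univ]; exact hM.measure_lt_top⟩

theorem IsClosedHypersurface.vol_pos (hM : IsClosedHypersurface M) : 0 < vol M := by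
  have := hM.isFiniteMeasure
  rw [vol, measureReal_def]
  refine ENNReal.toReal_pos ?_ (measure_ne_top _ _)
  obtain ⟨p, hp⟩ := hM.isConnected.nonempty
  obtain ⟨φ, π, U, x, hφ, hx, rfl⟩ := hM.exists_isChart hp
  rw [volumeMeasure, Measure.restrict_apply_univ]
  intro h0
  have h1 := measure_mono_null hφ.mapsTo.image_subset h0
  rw [hφ.isImmersionOn.euclideanHausdorffMeasure_image (by simp) hφ.isOpen.measurableSet
    Subset.rfl, lintegral_eq_zero_iff'
      (hφ.isImmersionOn.aemeasurable_normDet hφ.isOpen.measurableSet Subset.rfl).ennreal_ofReal,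
    EventuallyEq, ae_restrict_iff' hφ.isOpen.measurableSet] at h1
  have h2 : volume U = 0 := by
    refine measure_mono_null (fun y hy => ?_) h1
    simp only [mem_compl_iff, mem_ofPred_eq, Classical.not_imp]
    exact ⟨hy, by simpa using hφ.normDet_pos hy⟩
  exact (hφ.isOpen.measure_pos volume ⟨x, hx⟩).ne' h2

theorem IsClosedHypersurface.integrable_of_continuousOn (hM : IsClosedHypersurface M)
    {u : Ambient n → ℝ} (hu : ContinuousOn u M) : Integrable u (volumeMeasure M) := by
  obtain ⟨C, hC⟩ := hM.isCompact.exists_bound_of_continuousOn hu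
  have := hM.isFiniteMeasure
  exact Integrable.of_bound (hu.aestronglyMeasurable hM.measurableSet) C
    ((ae_restrict_iff' hM.measurableSet).2 (Eventually.of_forall hC))

/-- On a chart domain, the area formulas for `f ∘ φ` and for `φ` show that the pulled-back measure
and the one with density `|J(f)|` agree. The local equality is globalized by two applications of
`measure_le_of_locally_le`. -/
theorem IsDiffeo.vol_eq_integral (h : IsDiffeo 1 M N f) (hM : IsClosedHypersurface M)
    (hN : IsClosedHypersurface N) : vol N = ∫ p, |jacobian M N f p| ∂(volumeMeasure M) := by
  have hMm := hM.measurableSet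
  have hemb := h.1.continuousOn.measurableEmbedding hMm h.injOn
  let ν : Measure (Ambient n) := ((μHE[n] : Measure (Ambient n)).comap (M.domRestrict f)).map (↑)
  let κ : Measure (Ambient n) := μHE[n].withDensity fun p => ENNReal.ofReal |jacobian M N f p|
  have hν : ∀ B, MeasurableSet B → B ⊆ M → ν B = μHE[n] (f '' B) := by
    intro B hB hBU
    rw [Measure.map_apply measurable_subtype_coe hB, hemb.comap_apply]
    congr 1
    ext y
    constructor
    · rintro ⟨⟨x, hx⟩, hxB, rfl⟩
      exact ⟨x, hxB, rfl⟩
    · rintro ⟨x, hx, rfl⟩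
      exact ⟨⟨x, hBU hx⟩, hx, rfl⟩
  have key : ∀ p ∈ M, ∃ W, IsOpen W ∧ p ∈ W ∧ ∀ B, MeasurableSet B → B ⊆ M ∩ W → ν B = κ B := by
    intro p hp
    obtain ⟨φ, π, U, x, hφ, hx, rfl⟩ := hM.exists_isChart hp
    obtain ⟨W, hW, hUW⟩ := hφ.exists_isOpen
    refine ⟨W, hW, (hUW.subset (mem_image_of_mem φ hx)).2, fun B hB hBW => ?_⟩
    have hA : MeasurableSet (U ∩ φ ⁻¹' B) := by
      have h1 := (hφ.isImmersionOn.measurableEmbedding hφ.isOpen.measurableSet Subset.rfl).measurable hB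
      have h2 := (MeasurableEmbedding.subtype_coe hφ.isOpen.measurableSet).measurableSet_image.2 h1
      convert h2 using 1
      ext x
      simp [and_comm]
    have hBA : B = φ '' (U ∩ φ ⁻¹' B) := by
      rw [image_inter_preimage, hUW]
      exact (inter_eq_right.2 hBW).symm
    rw [hν B hB fun q hq => (hBW hq).1, withDensity_apply _ hB]
    conv_lhs => rw [hBA, ← image_comp]
    conv_rhs => rw [hBA]
    rw [(h.isImmersionOn_comp hφ).euclideanHausdorffMeasure_image (by simp) hA inter_subset_left,
      hφ.isImmersionOn.setLIntegral_image (by simp) hA inter_subset_left]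
    refine setLIntegral_congr_fun hA fun y hy => ?_
    rw [h.normDet_fderiv_comp hM hN hφ hy.1, mul_comm,
      ENNReal.ofReal_mul (LinearMap.normDet_nonneg _)]
  have hκν : ν M = κ M := by
    refine le_antisymm (measure_le_of_locally_le (fun p hp => ?_) hMm Subset.rfl)
      (measure_le_of_locally_le (fun p hp => ?_) hMm Subset.rfl)
    all_goals
      obtain ⟨W, hW, hpW, hB⟩ := key p hp
      exact ⟨W, hW, hpW, fun B h1 h2 => by rw [hB B h1 h2]⟩
  rw [hν M hMm Subset.rfl, h.image_eq, withDensity_apply _ hMm] at hκν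
  rw [vol, measureReal_def, volumeMeasure, Measure.restrict_apply_univ, hκν,
    integral_eq_lintegral_of_nonneg_ae (Eventually.of_forall fun p => abs_nonneg _)
      (hM.integrable_of_continuousOn (h.continuousOn_abs_jacobian hM hN)).aestronglyMeasurable]
  rfl

/-- The cross term `∫ |J(f)|` is the volume of the target, so competing diffeomorphisms differ only
in `∫ |J(f)|²`. -/
theorem IsDiffeo.stretchEnergy_eq (h : IsDiffeo 1 M N f) (hM : IsClosedHypersurface M)
    (hN : IsClosedHypersurface N) : stretchEnergy M N f =
      ∫ p, |jacobian M N f p| ^ 2 ∂(volumeMeasure M) - 2 * vol N + vol M := by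
  have := hM.isFiniteMeasure
  have hc := h.continuousOn_abs_jacobian hM hN
  have h1 := hM.integrable_of_continuousOn hc
  have h2 : Integrable (fun p => |jacobian M N f p| ^ 2) (volumeMeasure M) :=
    hM.integrable_of_continuousOn (hc.pow 2)
  rw [h.vol_eq_integral hM hN, stretchEnergy, ← integral_const_mul, ← integral_sub h2 (h1.const_mul 2)]
  have h3 : vol M = ∫ _, (1 : ℝ) ∂(volumeMeasure M) := by simp [vol]
  have h4 := integral_add (h2.sub (h1.const_mul 2)) (integrable_const (1 : ℝ))
  rw [h3]
  refine Eq.trans ?_ h4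
  refine integral_congr_ae (Eventually.of_forall fun p => ?_)
  simp only [Pi.sub_apply]
  ring

end Morphing

/-! ### Deforming a diffeomorphism inside a chart. -/

namespace Morphing

variable {n : ℕ} {M N : Set (Ambient n)} {φ : Model n → Ambient n} {π : Ambient n → Model n}
  {U K : Set (Model n)} {f : Ambient n → Ambient n}

theorem IsDiffeo.comp {r : ℕ∞} {P : Set (Ambient n)} {g : Ambient n → Ambient n}
    (hg : IsDiffeo r N P g) (hf : IsDiffeo r M N f) : IsDiffeo r M P (g ∘ f) := by
  obtain ⟨f1, f2, f', f3, f4, f5⟩ := hf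
  obtain ⟨g1, g2, g', g3, g4, g5⟩ := hg
  exact ⟨g1.comp f1 f2, g2.comp f2, f' ∘ g', f3.comp g3 g4, f4.comp g4, f5.comp g5 f2 g4⟩

theorem jacobian_congr {f' : Ambient n → Ambient n} {p : Ambient n} (h : f' =ᶠ[𝓝[M] p] f)
    (hp : f' p = f p) : jacobian M N f' p = jacobian M N f p := by
  unfold jacobian normalExtension
  rw [h.fderivWithin_eq hp, hp]

/-- A diffeomorphism of the parameter domain `U` that is the identity off the compact set `K`,
with its inverse. -/
structure IsLocalDiffeo (K : Set (Model n)) (Ψ Ψ' : Model n → Model n) : Prop where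
  contDiff : ContDiff ℝ ∞ Ψ
  contDiff_inv : ContDiff ℝ ∞ Ψ'
  left_inv : ∀ x, Ψ' (Ψ x) = x
  right_inv : ∀ x, Ψ (Ψ' x) = x
  eq_self : ∀ x ∉ K, Ψ x = x

namespace IsLocalDiffeo

variable {Ψ Ψ' : Model n → Model n}

theorem symm (h : IsLocalDiffeo K Ψ Ψ') : IsLocalDiffeo K Ψ' Ψ where
  contDiff := h.contDiff_inv
  contDiff_inv := h.contDiff
  left_inv := h.right_inv
  right_inv := h.left_inv
  eq_self x hx := by
    conv_lhs => rw [← h.eq_self x hx]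
    exact h.left_inv x

theorem mapsTo (h : IsLocalDiffeo K Ψ Ψ') : MapsTo Ψ K K := by
  intro x hx
  by_contra hn
  have h1 := h.symm.eq_self _ hn
  rw [h.left_inv] at h1
  exact hn (h1 ▸ hx)

theorem mapsTo_of_subset (h : IsLocalDiffeo K Ψ Ψ') (hKU : K ⊆ U) : MapsTo Ψ U U := by
  intro x hx
  by_cases hxK : x ∈ K
  · exact hKU (h.mapsTo hxK)
  · rwa [h.eq_self x hxK]

end IsLocalDiffeo

open Classical in
/-- The map of `M` that is `Ψ` in the chart `φ` and the identity elsewhere. -/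
noncomputable def transport (φ : Model n → Ambient n) (π : Ambient n → Model n)
    (U : Set (Model n)) (Ψ : Model n → Model n) (q : Ambient n) : Ambient n :=
  if q ∈ φ '' U then φ (Ψ (π q)) else q

section Transport

variable {Ψ Ψ' : Model n → Model n}

theorem IsChart.transport_apply (hφ : IsChart M φ π U) {x : Model n} (hx : x ∈ U) :
    transport φ π U Ψ (φ x) = φ (Ψ x) := by
  rw [transport, if_pos (mem_image_of_mem φ hx), hφ.left_inv x hx]

theorem IsChart.transport_of_notMem (hφ : IsChart M φ π U) (h : IsLocalDiffeo K Ψ Ψ')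
    {q : Ambient n} (hq : q ∉ φ '' K) : transport φ π U Ψ q = q := by
  by_cases hqU : q ∈ φ '' U
  · obtain ⟨x, hx, rfl⟩ := hqU
    rw [hφ.transport_apply hx, h.eq_self x fun hxK => hq (mem_image_of_mem φ hxK)]
  · rw [transport, if_neg hqU]

theorem IsChart.isCompact_image (hφ : IsChart M φ π U) (hK : IsCompact K) (hKU : K ⊆ U) :
    IsCompact (φ '' K) :=
  hK.image_of_continuousOn (hφ.contDiffOn.continuousOn.mono hKU)

theorem IsChart.mapsTo_transport (hφ : IsChart M φ π U) (hKU : K ⊆ U)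
    (h : IsLocalDiffeo K Ψ Ψ') : MapsTo (transport φ π U Ψ) M M := by
  intro q hq
  by_cases hqU : q ∈ φ '' U
  · obtain ⟨x, hx, rfl⟩ := hqU
    rw [hφ.transport_apply hx]
    exact hφ.mapsTo (h.mapsTo_of_subset hKU hx)
  · rwa [transport, if_neg hqU]

/-- Two relatively open pieces cover `M`: the chart domain, where the map is `φ ∘ Ψ ∘ π`, and the
complement of the compact set `φ '' K`, where it is the identity. -/
theorem IsChart.contDiffOn_transport (hφ : IsChart M φ π U) (hK : IsCompact K) (hKU : K ⊆ U)
    (h : IsLocalDiffeo K Ψ Ψ') : ContDiffOn ℝ ∞ (transport φ π U Ψ) M := by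
  intro q hq
  by_cases hqU : q ∈ φ '' U
  · have h1 : ContDiffOn ℝ ∞ (φ ∘ Ψ ∘ π) (φ '' U) := by
      refine hφ.contDiffOn.comp (h.contDiff.comp_contDiffOn hφ.contDiffOn_inv) ?_
      rintro _ ⟨x, hx, rfl⟩
      simp only [Function.comp_apply, hφ.left_inv x hx]
      exact h.mapsTo_of_subset hKU hx
    have h2 : ContDiffOn ℝ ∞ (transport φ π U Ψ) (φ '' U) :=
      h1.congr fun y hy => by rw [transport, if_pos hy]; rfl
    refine (h2 q hqU).mono_of_mem_nhdsWithin ?_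
    obtain ⟨x, hx, rfl⟩ := hqU
    exact hφ.image_mem_nhdsWithin hx
  · have hqK : q ∉ φ '' K := fun hn => hqU (image_mono hKU hn)
    have h1 : ∀ᶠ y in 𝓝 q, transport φ π U Ψ y = y := by
      filter_upwards [(hφ.isCompact_image hK hKU).isClosed.isOpen_compl.mem_nhds hqK] with y hy
      exact hφ.transport_of_notMem h hy
    exact (contDiffAt_id.congr_of_eventuallyEq h1).contDiffWithinAt

theorem IsChart.leftInvOn_transport (hφ : IsChart M φ π U) (hKU : K ⊆ U)
    (h : IsLocalDiffeo K Ψ Ψ') : LeftInvOn (transport φ π U Ψ') (transport φ π U Ψ) M := by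
  intro q hq
  by_cases hqU : q ∈ φ '' U
  · obtain ⟨x, hx, rfl⟩ := hqU
    rw [hφ.transport_apply hx, hφ.transport_apply (h.mapsTo_of_subset hKU hx), h.left_inv]
  · have h1 : transport φ π U Ψ q = q := by rw [transport, if_neg hqU]
    rw [h1, transport, if_neg hqU]

theorem IsChart.isDiffeo_transport (hφ : IsChart M φ π U) (hK : IsCompact K) (hKU : K ⊆ U)
    (h : IsLocalDiffeo K Ψ Ψ') (r : ℕ∞) : IsDiffeo r M M (transport φ π U Ψ) := by
  have hle : (r : WithTop ℕ∞) ≤ ∞ := by exact_mod_cast le_top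
  exact ⟨(hφ.contDiffOn_transport hK hKU h).of_le hle, hφ.mapsTo_transport hKU h,
    transport φ π U Ψ', (hφ.contDiffOn_transport hK hKU h.symm).of_le hle,
    hφ.mapsTo_transport hKU h.symm, hφ.leftInvOn_transport hKU h,
    hφ.leftInvOn_transport hKU h.symm⟩

theorem normDet_fderiv_comp_right {V : Type*} [NormedAddCommGroup V] [InnerProductSpace ℝ V]
    {φ : Model n → V} {x : Model n} (hφ : DifferentiableAt ℝ φ (Ψ x))
    (hΨ : DifferentiableAt ℝ Ψ x) :
    (fderiv ℝ (φ ∘ Ψ) x : Model n →ₗ[ℝ] V).normDet =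
      (fderiv ℝ φ (Ψ x) : Model n →ₗ[ℝ] V).normDet * |(fderiv ℝ Ψ x).det| := by
  rw [fderiv_comp x hφ hΨ, ContinuousLinearMap.toLinearMap_comp,
    LinearMap.normDet_comp_of_finrank_eq _ _ rfl, LinearMap.normDet_eq_abs_det]

/-- The energy of a minimizer does not decrease under a deformation in a chart. -/
theorem setIntegral_le_of_isMin (hM : IsClosedHypersurface M) (hN : IsClosedHypersurface N)
    {k : ℕ∞} (hk : 1 ≤ k) (hf : IsDiffeo k M N f)
    (hmin : ∀ h, IsDiffeo k M N h → stretchEnergy M N f ≤ stretchEnergy M N h)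
    (hφ : IsChart M φ π U) (hK : IsCompact K) (hKU : K ⊆ U) (hΨ : IsLocalDiffeo K Ψ Ψ') :
    ∫ x in K, (fderiv ℝ (f ∘ φ) x : Model n →ₗ[ℝ] Ambient n).normDet ^ 2 /
        (fderiv ℝ φ x : Model n →ₗ[ℝ] Ambient n).normDet ≤
      ∫ x in K, (fderiv ℝ (f ∘ φ) x : Model n →ₗ[ℝ] Ambient n).normDet ^ 2 /
        ((fderiv ℝ φ (Ψ x) : Model n →ₗ[ℝ] Ambient n).normDet * |(fderiv ℝ Ψ x).det|) := by
  set T := transport φ π U Ψ with hT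
  set T' := transport φ π U Ψ' with hT'
  -- The competitor uses the inverse deformation, so that `h ∘ T = f` on `M`. Parametrizing by `T ∘
  -- φ` then leaves the numerator of the energy density unchanged, and `Ψ` enters only through the
  -- denominator.
  set h := f ∘ T' with hh
  have hTd := hφ.isDiffeo_transport hK hKU hΨ 1
  have hf1 := hf.of_le hk
  have hhk : IsDiffeo k M N h := hf.comp (hφ.isDiffeo_transport hK hKU hΨ.symm k)
  have hh1 := hhk.of_le hk
  have hfin := hM.isFiniteMeasure
  have hKm : MeasurableSet (φ '' K) := (hφ.isCompact_image hK hKU).isClosed.measurableSet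
  have hKM : φ '' K ⊆ M := (hφ.mapsTo.mono_left hKU).image_subset
  have e1 := hmin h hhk
  rw [hf1.stretchEnergy_eq hM hN, hh1.stretchEnergy_eq hM hN] at e1
  have i1 := hM.integrable_of_continuousOn ((hf1.continuousOn_abs_jacobian hM hN).pow 2)
  have i2 := hM.integrable_of_continuousOn ((hh1.continuousOn_abs_jacobian hM hN).pow 2)
  have e2 : ∫ p in (φ '' K)ᶜ, |jacobian M N f p| ^ 2 ∂(volumeMeasure M) =
      ∫ p in (φ '' K)ᶜ, |jacobian M N h p| ^ 2 ∂(volumeMeasure M) := by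
    refine setIntegral_congr_fun hKm.compl fun p hp => ?_
    have hev : ∀ᶠ q in 𝓝 p, h q = f q := by
      filter_upwards [(hφ.isCompact_image hK hKU).isClosed.isOpen_compl.mem_nhds hp] with q hq
      rw [hh, Function.comp_apply, hT', hφ.transport_of_notMem hΨ.symm hq]
    rw [jacobian_congr (hev.filter_mono nhdsWithin_le_nhds) hev.self_of_nhds]
  have s1 := integral_add_compl hKm i1
  have s2 := integral_add_compl hKm i2
  simp only [Pi.pow_apply] at s1 s2
  have hres : (volumeMeasure M).restrict (φ '' K) = μHE[n].restrict (φ '' K) := by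
    rw [volumeMeasure, Measure.restrict_restrict hKm, inter_eq_left.2 hKM]
  rw [hres] at s1 s2
  have e3 : ∫ p in φ '' K, |jacobian M N f p| ^ 2 ∂μHE[n] ≤
      ∫ p in φ '' K, |jacobian M N h p| ^ 2 ∂μHE[n] := by
    linarith
  have hKm' : MeasurableSet K := hK.isClosed.measurableSet
  have hTφ : IsImmersionOn (T ∘ φ) U := hTd.isImmersionOn_comp hφ
  have himg : φ '' K = (T ∘ φ) '' K := by
    ext q
    constructor
    · rintro ⟨x, hx, rfl⟩
      refine ⟨Ψ' x, hΨ.symm.mapsTo hx, ?_⟩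
      rw [Function.comp_apply, hT, hφ.transport_apply (hKU (hΨ.symm.mapsTo hx)), hΨ.right_inv]
    · rintro ⟨x, hx, rfl⟩
      refine ⟨Ψ x, hΨ.mapsTo hx, ?_⟩
      rw [Function.comp_apply, hT, hφ.transport_apply (hKU hx)]
  have e4 : ∫ p in φ '' K, |jacobian M N f p| ^ 2 ∂μHE[n] =
      ∫ x in K, (fderiv ℝ (f ∘ φ) x : Model n →ₗ[ℝ] Ambient n).normDet ^ 2 /
        (fderiv ℝ φ x : Model n →ₗ[ℝ] Ambient n).normDet := by
    rw [hφ.isImmersionOn.setIntegral_image (by simp) hKm' hKU]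
    refine setIntegral_congr_fun hKm' fun x hx => ?_
    have := hφ.normDet_pos (hKU hx)
    rw [hf1.normDet_fderiv_comp hM hN hφ (hKU hx)]
    field_simp
  have e5 : ∫ p in φ '' K, |jacobian M N h p| ^ 2 ∂μHE[n] =
      ∫ x in K, (fderiv ℝ (f ∘ φ) x : Model n →ₗ[ℝ] Ambient n).normDet ^ 2 /
        ((fderiv ℝ φ (Ψ x) : Model n →ₗ[ℝ] Ambient n).normDet * |(fderiv ℝ Ψ x).det|) := by
    rw [himg, hTφ.setIntegral_image (by simp) hKm' hKU]
    refine setIntegral_congr_fun hKm' fun x hx => ?_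
    have hxU := hKU hx
    have hpos : 0 < (fderiv ℝ (T ∘ φ) x : Model n →ₗ[ℝ] Ambient n).normDet :=
      Morphing.normDet_pos (hTφ.injective_fderiv x hxU)
    have hUx := hφ.isOpen.mem_nhds hxU
    have hd : DifferentiableAt ℝ (T ∘ φ) x :=
      (hTφ.contDiffOn.contDiffAt hUx).differentiableAt one_ne_zero
    have hm : MapsTo (T ∘ φ) U M := hTd.2.1.comp hφ.mapsTo
    have h1 := Morphing.normDet_fderiv_comp hM hN hφ.isOpen hm hh1.2.1 hxU hd
      (hh1.differentiableWithinAt (hm hxU))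
    have h2 : h ∘ (T ∘ φ) =ᶠ[𝓝 x] f ∘ φ := by
      filter_upwards [hUx] with y hy
      simp only [hh, Function.comp_apply]
      rw [hT, hT', hφ.leftInvOn_transport hKU hΨ (hφ.mapsTo hy)]
    have h3 : T ∘ φ =ᶠ[𝓝 x] φ ∘ Ψ := by
      filter_upwards [hUx] with y hy
      simp only [Function.comp_apply, hT]
      rw [hφ.transport_apply hy]
    have h4 := normDet_fderiv_comp_right (φ := φ) (Ψ := Ψ) (x := x)
      (hφ.differentiableAt (hΨ.mapsTo_of_subset hKU hxU))
      (hΨ.contDiff.differentiable (by simp) x)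
    rw [h2.fderiv_eq] at h1
    rw [← h3.fderiv_eq] at h4
    rw [← h4, h1]
    simp only [Function.comp_apply]
    field_simp
  rw [e4, e5] at e3
  exact e3

end Transport

end Morphing

/-! ### First variation and the Euler-Lagrange equation. -/

namespace Morphing

variable {n : ℕ} {U K : Set (Model n)}

theorem hasDerivAt_setIntegral_of_continuousOn (hK : IsCompact K) {δ : ℝ} (hδ : 0 < δ)
    {q q' : ℝ → Model n → ℝ} (hq : ContinuousOn (Function.uncurry q) (Icc (-δ) δ ×ˢ K))
    (hq' : ContinuousOn (Function.uncurry q') (Icc (-δ) δ ×ˢ K))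
    (hd : ∀ ε ∈ Icc (-δ) δ, ∀ y ∈ K, HasDerivAt (fun e => q e y) (q' ε y) ε) :
    HasDerivAt (fun ε => ∫ y in K, q ε y) (∫ y in K, q' 0 y) 0 := by
  have hKm := hK.isClosed.measurableSet
  have hsec : ∀ {r : ℝ → Model n → ℝ}, ContinuousOn (Function.uncurry r) (Icc (-δ) δ ×ˢ K) →
      ∀ ε ∈ Icc (-δ) δ, ContinuousOn (r ε) K := fun hr ε hε =>
    hr.comp (by fun_prop : Continuous fun y : Model n => (ε, y)).continuousOn
      fun y hy => ⟨hε, hy⟩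
  have h0 : (0 : ℝ) ∈ Icc (-δ) δ := ⟨by linarith, hδ.le⟩
  obtain ⟨C, hC⟩ := (isCompact_Icc.prod hK).exists_bound_of_continuousOn hq'
  refine (hasDerivAt_integral_of_dominated_loc_of_deriv_le (bound := fun _ => C)
    (Icc_mem_nhds (by linarith) hδ : Icc (-δ) δ ∈ 𝓝 0) ?_ ?_ ?_ ?_ ?_ ?_).2
  · filter_upwards [Icc_mem_nhds (by linarith : -δ < 0) hδ] with ε hε
    exact (hsec hq ε hε).aestronglyMeasurable hKm
  · exact (hsec hq 0 h0).integrableOn_compact hK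
  · exact (hsec hq' 0 h0).aestronglyMeasurable hKm
  · exact (ae_restrict_iff' hKm).2 (Eventually.of_forall fun y hy ε hε => hC (ε, y) ⟨hε, hy⟩)
  · exact integrableOn_const hK.measure_lt_top.ne
  · exact (ae_restrict_iff' hKm).2 (Eventually.of_forall fun y hy ε hε => hd ε hε y hy)

theorem det_id_add_smulRight (ℓ : Model n →L[ℝ] ℝ) (v : Model n) :
    (ContinuousLinearMap.id ℝ (Model n) + ℓ.smulRight v).det = 1 + ℓ v := by
  have h := LinearMap.transvection.det (ℓ : Model n →ₗ[ℝ] ℝ) v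
  have h2 : ((ContinuousLinearMap.id ℝ (Model n) + ℓ.smulRight v : Model n →L[ℝ] Model n) :
      Model n →ₗ[ℝ] Model n) = LinearMap.transvection (ℓ : Model n →ₗ[ℝ] ℝ) v := by
    ext x
    simp [LinearMap.transvection.apply]
  rw [ContinuousLinearMap.det, h2, h]
  rfl

theorem eq_zero_of_tsupport {b : Model n → ℝ} (hb : ∀ x ∉ K, b x = 0) (hK : IsCompact K)
    {x : Model n} (hx : x ∉ K) : b =ᶠ[𝓝 x] 0 := by
  filter_upwards [hK.isClosed.isOpen_compl.mem_nhds hx] with y hy using hb y hy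

/-- A small displacement in the direction `v`, cut off by `b`, is a diffeomorphism. -/
theorem exists_isLocalDiffeo (hK : IsCompact K) {b : Model n → ℝ} (hb : ContDiff ℝ ∞ b)
    (hbK : ∀ x ∉ K, b x = 0) (v : Model n) :
    ∃ δ > 0, ∀ ε : ℝ, |ε| ≤ δ → (∃ Ψ', IsLocalDiffeo K (fun x => x + (ε * b x) • v) Ψ') ∧
      ∀ x, 0 < 1 + ε * fderiv ℝ b x v ∧
        (fderiv ℝ (fun x => x + (ε * b x) • v) x).det = 1 + ε * fderiv ℝ b x v := by
  have hcs : HasCompactSupport b := HasCompactSupport.intro hK hbK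
  obtain ⟨C, hC⟩ := hb.lipschitzWith_of_hasCompactSupport hcs (by simp)
  have hden : 0 < 2 * (C * ‖v‖ + 1) := by positivity
  -- With `C` a Lipschitz constant of `b`, this bound makes the displacement `1/2`-Lipschitz: the
  -- map is then a homeomorphism and its determinant is at least `1/2`. The `+ 1` keeps the
  -- denominator positive.
  refine ⟨1 / (2 * (C * ‖v‖ + 1)), by positivity, fun ε hε => ?_⟩
  have hsmall : |ε| * (C * ‖v‖) ≤ 1 / 2 := by
    rw [le_div_iff₀ hden] at hε
    nlinarith [abs_nonneg ε, mul_nonneg C.coe_nonneg (norm_nonneg v)]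
  have hpos : ∀ x, 0 < 1 + ε * fderiv ℝ b x v := by
    intro x
    have h1 : |fderiv ℝ b x v| ≤ C * ‖v‖ :=
      ((fderiv ℝ b x).le_opNorm v).trans
        (mul_le_mul_of_nonneg_right (norm_fderiv_le_of_lipschitz ℝ hC) (norm_nonneg v))
    have h2 : |ε * fderiv ℝ b x v| ≤ 1 / 2 := by
      rw [abs_mul]
      exact (mul_le_mul_of_nonneg_left h1 (abs_nonneg ε)).trans hsmall
    linarith [neg_abs_le (ε * fderiv ℝ b x v)]
  have hder : ∀ x, HasFDerivAt (fun x => x + (ε * b x) • v)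
      (ContinuousLinearMap.id ℝ (Model n) + (ε • fderiv ℝ b x).smulRight v) x := by
    intro x
    have h1 := ((hb.differentiable (by simp) x).hasFDerivAt.const_mul ε).smul_const v
    exact (hasFDerivAt_id x).add h1
  have hdet : ∀ x, (fderiv ℝ (fun x => x + (ε * b x) • v) x).det = 1 + ε * fderiv ℝ b x v := by
    intro x
    rw [(hder x).fderiv, det_id_add_smulRight]
    simp
  refine ⟨?_, fun x => ⟨hpos x, hdet x⟩⟩
  have hsm : ContDiff ℝ ∞ (fun x => x + (ε * b x) • v) :=
    contDiff_id.add ((contDiff_const.mul hb).smul contDiff_const)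
  have happ : ApproximatesLinearOn (fun x => x + (ε * b x) • v)
      ((ContinuousLinearEquiv.refl ℝ (Model n) : Model n ≃L[ℝ] Model n) : Model n →L[ℝ] Model n)
      univ (1 / 2) := by
    intro x _ y _
    have h1 : x + (ε * b x) • v - (y + (ε * b y) • v) -
        ((ContinuousLinearEquiv.refl ℝ (Model n) : Model n ≃L[ℝ] Model n) :
          Model n →L[ℝ] Model n) (x - y) = (ε * (b x - b y)) • v := by
      simp only [ContinuousLinearEquiv.coe_refl, ContinuousLinearMap.id_apply]
      rw [mul_sub, sub_smul]
      abel
    have h2 : |b x - b y| ≤ C * ‖x - y‖ := by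
      have := hC.dist_le_mul x y
      rwa [Real.dist_eq, dist_eq_norm] at this
    rw [h1, norm_smul, Real.norm_eq_abs, abs_mul]
    calc |ε| * |b x - b y| * ‖v‖ ≤ |ε| * (C * ‖x - y‖) * ‖v‖ := by gcongr
      _ = |ε| * (C * ‖v‖) * ‖x - y‖ := by ring
      _ ≤ 1 / 2 * ‖x - y‖ := by gcongr
      _ = _ := by norm_num
  have hc : Subsingleton (Model n) ∨ (1 / 2 : NNReal) <
      ‖((ContinuousLinearEquiv.refl ℝ (Model n)).symm : Model n →L[ℝ] Model n)‖₊⁻¹ := by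
    rcases subsingleton_or_nontrivial (Model n) with h | h
    · exact Or.inl h
    · right
      have : ‖((ContinuousLinearEquiv.refl ℝ (Model n)).symm : Model n →L[ℝ] Model n)‖₊ = 1 := by
        ext
        exact ContinuousLinearMap.norm_id
      rw [this, inv_one]
      exact NNReal.half_lt_self one_ne_zero
  let H := happ.toHomeomorph _ hc
  have hH : ∀ x, H x = x + (ε * b x) • v := fun x => rfl
  have hne : ∀ x, (ContinuousLinearMap.id ℝ (Model n) +
      (ε • fderiv ℝ b x).smulRight v).det ≠ 0 := fun x => by
    rw [← (hder x).fderiv, hdet x]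
    exact (hpos x).ne'
  have hinv : ContDiff ℝ ∞ H.symm :=
    H.contDiff_symm (f₀' := fun x => ContinuousLinearMap.toContinuousLinearEquivOfDetNeZero _ (hne x))
      (fun x => by
        rw [ContinuousLinearMap.coe_toContinuousLinearEquivOfDetNeZero]
        exact hder x) hsm
  exact ⟨H.symm, hsm, hinv, fun x => H.symm_apply_apply x, fun x => H.apply_symm_apply x,
    fun x hx => by simp [hbK x hx]⟩

variable {a g : Model n → ℝ}

/-- Along `Ψ_ε(x) = x + ε b(x) v` the denominator is `ρ_ε = g(Ψ_ε) (1 + ε ∂_v b)`, whose derivative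
at `ε = 0` is `∂_v (g b)`. Since `ε = 0` is a local minimum of `∫ a / ρ_ε`, the derivative there,
`-∫ (a / g²) ∂_v (g b)`, vanishes. -/
theorem setIntegral_variation_eq_zero (hU : IsOpen U) (ha : ContinuousOn a U)
    (hg : ContDiffOn ℝ 1 g U) (hgpos : ∀ x ∈ U, 0 < g x)
    (hmin : ∀ K Ψ Ψ', IsCompact K → K ⊆ U → IsLocalDiffeo K Ψ Ψ' →
      ∫ x in K, a x / g x ≤ ∫ x in K, a x / (g (Ψ x) * |(fderiv ℝ Ψ x).det|))
    (hK : IsCompact K) (hKU : K ⊆ U) {b : Model n → ℝ} (hb : ContDiff ℝ ∞ b)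
    (hbK : ∀ x ∉ K, b x = 0) (v : Model n) :
    ∫ x in K, a x / g x ^ 2 * fderiv ℝ (fun y => g y * b y) x v = 0 := by
  obtain ⟨δ, hδ, hΨ⟩ := exists_isLocalDiffeo hK hb hbK v
  have hmem : ∀ ε ∈ Icc (-δ) δ, ∀ y ∈ K, y + (ε * b y) • v ∈ U := by
    intro ε hε y hy
    obtain ⟨⟨Ψ', h⟩, -⟩ := hΨ ε (abs_le.2 hε)
    exact hKU (h.mapsTo hy)
  have hbc : Continuous b := hb.continuous
  have hb'c : Continuous (fderiv ℝ b) := hb.continuous_fderiv (by simp)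
  set ρ : ℝ → Model n → ℝ := fun ε y => g (y + (ε * b y) • v) * (1 + ε * fderiv ℝ b y v) with hρ
  set ρ' : ℝ → Model n → ℝ := fun ε y => fderiv ℝ g (y + (ε * b y) • v) (b y • v) *
    (1 + ε * fderiv ℝ b y v) + g (y + (ε * b y) • v) * fderiv ℝ b y v with hρ'
  have hρpos : ∀ ε ∈ Icc (-δ) δ, ∀ y ∈ K, 0 < ρ ε y := fun ε hε y hy =>
    mul_pos (hgpos _ (hmem ε hε y hy)) ((hΨ ε (abs_le.2 hε)).2 y).1
  have hcurve : Continuous fun z : ℝ × Model n => z.2 + (z.1 * b z.2) • v := by fun_prop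
  have hmaps : MapsTo (fun z : ℝ × Model n => z.2 + (z.1 * b z.2) • v) (Icc (-δ) δ ×ˢ K) U :=
    fun z hz => hmem z.1 hz.1 z.2 hz.2
  have hgc : ContinuousOn (fun z : ℝ × Model n => g (z.2 + (z.1 * b z.2) • v))
      (Icc (-δ) δ ×ˢ K) := hg.continuousOn.comp hcurve.continuousOn hmaps
  have hg'c : ContinuousOn (fun z : ℝ × Model n => fderiv ℝ g (z.2 + (z.1 * b z.2) • v))
      (Icc (-δ) δ ×ˢ K) :=
    (hg.continuousOn_fderiv_of_isOpen hU le_rfl).comp hcurve.continuousOn hmaps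
  have hfac : Continuous fun z : ℝ × Model n => 1 + z.1 * fderiv ℝ b z.2 v := by fun_prop
  have hac : ContinuousOn (fun z : ℝ × Model n => a z.2) (Icc (-δ) δ ×ˢ K) :=
    ha.comp continuous_snd.continuousOn fun z hz => hKU hz.2
  have hρc : ContinuousOn (Function.uncurry ρ) (Icc (-δ) δ ×ˢ K) := hgc.mul hfac.continuousOn
  have hρ'c : ContinuousOn (Function.uncurry ρ') (Icc (-δ) δ ×ˢ K) := by
    refine ((hg'c.clm_apply ?_).mul hfac.continuousOn).add (hgc.mul ?_)
    · exact (by fun_prop : Continuous fun z : ℝ × Model n => b z.2 • v).continuousOn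
    · exact (by fun_prop : Continuous fun z : ℝ × Model n => fderiv ℝ b z.2 v).continuousOn
  have hρd : ∀ ε ∈ Icc (-δ) δ, ∀ y ∈ K, HasDerivAt (fun e => ρ e y) (ρ' ε y) ε := by
    intro ε hε y hy
    have h1 : HasDerivAt (fun e : ℝ => y + (e * b y) • v) (b y • v) ε := by
      have := (((hasDerivAt_id ε).mul_const (b y)).smul_const v).const_add y
      simpa using this
    have h2 := ((hg.contDiffAt (hU.mem_nhds (hmem ε hε y hy))).differentiableAt
      one_ne_zero).hasFDerivAt.comp_hasDerivAt ε h1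
    have h3 : HasDerivAt (fun e : ℝ => 1 + e * fderiv ℝ b y v) (fderiv ℝ b y v) ε := by
      simpa using ((hasDerivAt_id ε).mul_const (fderiv ℝ b y v)).const_add 1
    exact h2.mul h3
  have hq'c : ContinuousOn (Function.uncurry fun ε y => -(a y * ρ' ε y) / ρ ε y ^ 2)
      (Icc (-δ) δ ×ˢ K) := by
    have h1 := (hac.mul hρ'c).neg.div (hρc.pow 2)
      fun z hz => (pow_pos (hρpos z.1 hz.1 z.2 hz.2) 2).ne'
    exact h1.congr fun z _ => rfl
  have hder := hasDerivAt_setIntegral_of_continuousOn hK hδ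
    (q := fun ε y => a y / ρ ε y) (q' := fun ε y => -(a y * ρ' ε y) / ρ ε y ^ 2)
    (hac.div hρc fun z hz => (hρpos z.1 hz.1 z.2 hz.2).ne')
    hq'c (fun ε hε y hy => by
      have := (hasDerivAt_const ε (a y)).fun_div (hρd ε hε y hy) (hρpos ε hε y hy).ne'
      simpa using this)
  have hloc : IsLocalMin (fun ε => ∫ y in K, a y / ρ ε y) 0 := by
    filter_upwards [Icc_mem_nhds (by linarith : -δ < 0) hδ] with ε hε
    obtain ⟨⟨Ψ', h⟩, hdet⟩ := hΨ ε (abs_le.2 hε)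
    have h1 := hmin K _ _ hK hKU h
    have h2 : ∀ y, ρ 0 y = g y := fun y => by simp [hρ]
    have h3 : ∀ y, g (y + (ε * b y) • v) *
        |(fderiv ℝ (fun x => x + (ε * b x) • v) y).det| = ρ ε y := fun y => by
      rw [(hdet y).2, abs_of_pos (hdet y).1]
    simpa only [h2, h3] using h1
  have hz := hloc.hasDerivAt_eq_zero hder
  rw [← neg_eq_zero, ← integral_neg, ← hz]
  refine setIntegral_congr_fun hK.isClosed.measurableSet fun y hy => ?_
  have hgy : HasFDerivAt g (fderiv ℝ g y) y :=
    ((hg.contDiffAt (hU.mem_nhds (hKU hy))).differentiableAt one_ne_zero).hasFDerivAt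
  have hby : HasFDerivAt b (fderiv ℝ b y) y := (hb.differentiable (by simp) y).hasFDerivAt
  rw [(hgy.fun_mul hby).fderiv]
  simp [hρ, hρ']
  ring

/-- Integration by parts on the whole space: `g b` vanishes off `K`, so there are no boundary terms,
and `w` needs to be differentiable only on the support of `g b`. -/
theorem setIntegral_fderiv_mul_eq_zero (hU : IsOpen U) {w : Model n → ℝ}
    (hw : ContDiffOn ℝ 1 w U) (hg : ContDiffOn ℝ 1 g U)
    (hK : IsCompact K) (hKU : K ⊆ U) {b : Model n → ℝ} (hb : ContDiff ℝ ∞ b)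
    (hbK : ∀ x ∉ K, b x = 0) (v : Model n)
    (h0 : ∫ x in K, w x * fderiv ℝ (fun y => g y * b y) x v = 0) :
    ∫ x in K, fderiv ℝ w x v * (g x * b x) = 0 := by
  have hgb0 : ∀ x ∉ K, g x * b x = 0 := fun x hx => by rw [hbK x hx, mul_zero]
  have hgb0' : ∀ x ∉ K, fderiv ℝ (fun y => g y * b y) x = 0 := fun x hx => by
    rw [(eq_zero_of_tsupport hgb0 hK hx).fderiv_eq]
    exact fderiv_const_apply 0
  have hgbU : ContDiffOn ℝ 1 (fun y => g y * b y) U := hg.mul (hb.of_le (by simp)).contDiffOn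
  have hgbd : Differentiable ℝ (fun y => g y * b y) := fun x => by
    by_cases hx : x ∈ K
    · exact (hgbU.contDiffAt (hU.mem_nhds (hKU hx))).differentiableAt one_ne_zero
    · exact (differentiableAt_const (0 : ℝ)).congr_of_eventuallyEq
        (eq_zero_of_tsupport hgb0 hK hx)
  have hint : ∀ F : Model n → ℝ, ContinuousOn F K → (∀ x ∉ K, F x = 0) → Integrable F := by
    intro F hF hF0
    rw [← integrableOn_iff_integrable_of_support_subset (s := K)]
    · exact hF.integrableOn_compact hK
    · intro x hx
      by_contra hn
      exact hx (hF0 x hn)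
  have hts : tsupport (fun y => g y * b y) ⊆ K := by
    refine closure_minimal (fun x hx => ?_) hK.isClosed
    by_contra hn
    exact hx (hgb0 x hn)
  have hwc := hw.continuousOn.mono hKU
  have hgbc := hgbU.continuousOn.mono hKU
  have hw'c : ContinuousOn (fun x => fderiv ℝ w x v) K :=
    ((hw.continuousOn_fderiv_of_isOpen hU le_rfl).mono hKU).clm_apply continuousOn_const
  have hgb'c : ContinuousOn (fun x => fderiv ℝ (fun y => g y * b y) x v) K :=
    ((hgbU.continuousOn_fderiv_of_isOpen hU le_rfl).mono hKU).clm_apply continuousOn_const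
  have z1 : ∀ x ∉ K, fderiv ℝ w x v * (g x * b x) = 0 := fun x hx => by rw [hgb0 x hx, mul_zero]
  have z2 : ∀ x ∉ K, w x * fderiv ℝ (fun y => g y * b y) x v = 0 := fun x hx => by
    rw [hgb0' x hx]; simp
  have hparts := integral_mul_fderiv_eq_neg_fderiv_mul_of_integrable (μ := volume) (f := w)
    (g := fun y => g y * b y) (v := v) (hint _ (hw'c.mul hgbc) z1) (hint _ (hwc.mul hgb'c) z2)
    (hint _ (hwc.mul hgbc) fun x hx => by rw [hgb0 x hx, mul_zero])
    (fun x hx => (hw.contDiffAt (hU.mem_nhds (hKU (hts hx)))).differentiableAt one_ne_zero)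
    (fun x _ => hgbd x)
  rw [setIntegral_eq_integral_of_forall_compl_eq_zero z2, hparts, neg_eq_zero] at h0
  rw [setIntegral_eq_integral_of_forall_compl_eq_zero z1, h0]

/-- The Euler-Lagrange equation of the distortion energy in a chart. -/
theorem fderiv_div_sq_eq_zero (hU : IsOpen U) (ha : ContDiffOn ℝ 1 a U)
    (hg : ContDiffOn ℝ 1 g U) (hgpos : ∀ x ∈ U, 0 < g x)
    (hmin : ∀ K Ψ Ψ', IsCompact K → K ⊆ U → IsLocalDiffeo K Ψ Ψ' →
      ∫ x in K, a x / g x ≤ ∫ x in K, a x / (g (Ψ x) * |(fderiv ℝ Ψ x).det|))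
    {x : Model n} (hx : x ∈ U) : fderiv ℝ (fun y => a y / g y ^ 2) x = 0 := by
  have hw : ContDiffOn ℝ 1 (fun y => a y / g y ^ 2) U :=
    ha.div (hg.pow 2) fun y hy => (pow_pos (hgpos y hy) 2).ne'
  -- If the derivative were positive at `x`, it would be so on a small ball; testing with a bump
  -- function there gives a positive integral that should vanish. Using both `v` and `-v` excludes
  -- either sign.
  have hle : ∀ v, ¬ 0 < fderiv ℝ (fun y => a y / g y ^ 2) x v := by
    intro v hv
    have hc : ContinuousAt (fun y => fderiv ℝ (fun y => a y / g y ^ 2) y v) x :=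
      ((hw.continuousOn_fderiv_of_isOpen hU le_rfl).clm_apply continuousOn_const).continuousAt
        (hU.mem_nhds hx)
    obtain ⟨r, hr, hrs⟩ := Metric.nhds_basis_closedBall.mem_iff.1
      ((hc.eventually_const_lt hv).and (hU.mem_nhds hx))
    let b : ContDiffBump x := ⟨r / 2, r, by linarith, by linarith⟩
    have hKU : Metric.closedBall x r ⊆ U := fun y hy => (hrs hy).2
    have hbK : ∀ y ∉ Metric.closedBall x r, b y = 0 := fun y hy =>
      b.zero_of_le_dist (not_le.1 hy).le
    have hK := isCompact_closedBall x r
    have h0 := setIntegral_fderiv_mul_eq_zero hU hw hg hK hKU b.contDiff hbK v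
      (setIntegral_variation_eq_zero hU ha.continuousOn hg hgpos hmin hK hKU b.contDiff hbK v)
    refine h0.not_gt ?_
    rw [setIntegral_pos_iff_support_of_nonneg_ae]
    · refine (Metric.measure_ball_pos volume x hr).trans_le
        (measure_mono fun y hy => ?_)
      have hy' := Metric.ball_subset_closedBall hy
      exact ⟨(mul_pos (hrs hy').1 (mul_pos (hgpos y (hKU hy')) (b.pos_of_mem_ball hy))).ne', hy'⟩
    · refine (ae_restrict_iff' hK.isClosed.measurableSet).2 (Eventually.of_forall fun y hy => ?_)
      exact mul_nonneg (hrs hy).1.le (mul_nonneg (hgpos y (hKU hy)).le b.nonneg)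
    · refine ContinuousOn.integrableOn_compact hK ?_
      exact (((hw.continuousOn_fderiv_of_isOpen hU le_rfl).clm_apply continuousOn_const).mul
        (hg.continuousOn.mul b.continuous.continuousOn)).mono hKU
  ext v
  have h1 := hle v
  have h2 := hle (-v)
  rw [map_neg] at h2
  simp only [zero_apply]
  linarith

end Morphing

/-! ### Minimizers have constant Jacobian. -/

namespace Morphing

variable {n : ℕ} {M N : Set (Ambient n)} {φ : Model n → Ambient n} {π : Ambient n → Model n}
  {U K : Set (Model n)} {f : Ambient n → Ambient n}

theorem IsChart.contDiffOn_normDet (hφ : IsChart M φ π U) :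
    ContDiffOn ℝ 1 (fun x => (fderiv ℝ φ x : Model n →ₗ[ℝ] Ambient n).normDet) U := by
  intro x hx
  have h1 : ContDiffOn ℝ 1 (fderiv ℝ φ) U :=
    (hφ.contDiffOn.of_le two_le_infty).fderiv_of_isOpen hφ.isOpen
      (by norm_num : (1 : WithTop ℕ∞) + 1 ≤ 2)
  exact (contDiffAt_normDet (hφ.isImmersionOn.injective_fderiv x hx)).comp_contDiffWithinAt x
    (h1 x hx)

/-- The Jacobian of a diffeomorphism that minimizes the distortion energy is constant. -/
theorem abs_jacobian_eq_of_isMin (hM : IsClosedHypersurface M) (hN : IsClosedHypersurface N)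
    {k : ℕ∞} (hk : 1 ≤ k) (hf : IsDiffeo k M N f) (hf2 : IsDiffeo 2 M N f)
    (hmin : ∀ h, IsDiffeo k M N h → stretchEnergy M N f ≤ stretchEnergy M N h)
    {p q : Ambient n} (hp : p ∈ M) (hq : q ∈ M) :
    |jacobian M N f p| = |jacobian M N f q| := by
  have hf1 := hf.of_le hk
  -- Connectedness reduces the claim to local constancy, since equality of values is transitive.
  refine hM.isConnected.isPreconnected.induction₂'
    (fun p q => |jacobian M N f p| = |jacobian M N f q|) (fun p hp => ?_)
    (fun _ _ _ _ _ _ h1 h2 => h1.trans h2) hp hq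
  obtain ⟨φ, π, U, x, hφ, hx, rfl⟩ := hM.exists_isChart hp
  obtain ⟨r, hr, hrU⟩ := Metric.isOpen_iff.1 hφ.isOpen x hx
  have hball := hφ.restrict Metric.isOpen_ball hrU
  suffices h : ∀ y ∈ Metric.ball x r, |jacobian M N f (φ y)| = |jacobian M N f (φ x)| by
    filter_upwards [hball.image_mem_nhdsWithin (Metric.mem_ball_self hr)]
    rintro _ ⟨y, hy, rfl⟩
    exact ⟨(h y hy).symm, h y hy⟩
  set a : Model n → ℝ := fun y => (fderiv ℝ (f ∘ φ) y : Model n →ₗ[ℝ] Ambient n).normDet ^ 2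
  set g : Model n → ℝ := fun y => (fderiv ℝ φ y : Model n →ₗ[ℝ] Ambient n).normDet
  -- The Euler-Lagrange equation needs a `C^1` density, hence a `C^2` map; this is why `hf2` is
  -- assumed separately from the class `k` of the competitors, which may be `1`.
  have ha : ContDiffOn ℝ 1 a U := by
    have h2 : ContDiffOn ℝ 2 (f ∘ φ) U :=
      hf2.1.comp (hφ.contDiffOn.of_le two_le_infty) hφ.mapsTo
    exact contDiff_normDet_sq.comp_contDiffOn
      (h2.fderiv_of_isOpen hφ.isOpen (by norm_num : (1 : WithTop ℕ∞) + 1 ≤ 2))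
  have hz : ∀ y ∈ U, fderiv ℝ (fun y => a y / g y ^ 2) y = 0 := fun y hy =>
    fderiv_div_sq_eq_zero hφ.isOpen ha hφ.contDiffOn_normDet (fun y hy => hφ.normDet_pos hy)
      (fun K Ψ Ψ' hK hKU hΨ => setIntegral_le_of_isMin hM hN hk hf hmin hφ hK hKU hΨ) hy
  have hw : ∀ y ∈ U, a y / g y ^ 2 = |jacobian M N f (φ y)| ^ 2 := fun y hy => by
    rw [hf1.abs_jacobian_eq_div hM hN hφ hy, div_pow]
  have hd : DifferentiableOn ℝ (fun y => a y / g y ^ 2) U :=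
    (ha.div (hφ.contDiffOn_normDet.pow 2)
      fun y hy => (pow_pos (hφ.normDet_pos hy) 2).ne').differentiableOn one_ne_zero
  intro y hy
  have hxm := Metric.mem_ball_self (x := x) hr
  have h := Metric.isOpen_ball.is_const_of_fderiv_eq_zero
    (convex_ball x r).isPreconnected (hd.mono hrU) (fun z hz' => hz z (hrU hz')) hy hxm
  beta_reduce at h
  rw [hw y (hrU hy), hw x hx] at h
  exact (pow_left_inj₀ (abs_nonneg _) (abs_nonneg _) two_ne_zero).1 h

/-- The constant is determined by integrating it over `M`, which must give the volume of `N`. -/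
theorem abs_jacobian_eq_vol_div (hM : IsClosedHypersurface M) (hN : IsClosedHypersurface N)
    {k : ℕ∞} (hk : 1 ≤ k) (hf : IsDiffeo k M N f) (hf2 : IsDiffeo 2 M N f)
    (hmin : ∀ h, IsDiffeo k M N h → stretchEnergy M N f ≤ stretchEnergy M N h)
    {p : Ambient n} (hp : p ∈ M) : |jacobian M N f p| = vol N / vol M := by
  rw [eq_div_iff hM.vol_pos.ne', (hf.of_le hk).vol_eq_integral hM hN]
  have h : ∫ q, |jacobian M N f q| ∂(volumeMeasure M) =
      ∫ _, |jacobian M N f p| ∂(volumeMeasure M) :=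
    setIntegral_congr_fun hM.measurableSet fun q hq =>
      abs_jacobian_eq_of_isMin hM hN hk hf hf2 hmin hq hp
  rw [h, integral_const, smul_eq_mul, mul_comm]
  rfl

theorem stretchEnergy_eq_of_isMin (hM : IsClosedHypersurface M) (hN : IsClosedHypersurface N)
    {k : ℕ∞} (hk : 1 ≤ k) (hf : IsDiffeo k M N f) (hf2 : IsDiffeo 2 M N f)
    (hmin : ∀ h, IsDiffeo k M N h → stretchEnergy M N f ≤ stretchEnergy M N h) :
    stretchEnergy M N f = (vol N - vol M) ^ 2 / vol M := by
  have h : stretchEnergy M N f = ∫ _, (vol N / vol M - 1) ^ 2 ∂(volumeMeasure M) :=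
    setIntegral_congr_fun hM.measurableSet fun q hq => by
      rw [abs_jacobian_eq_vol_div hM hN hk hf hf2 hmin hq]
  have hv := hM.vol_pos
  rw [h, integral_const, smul_eq_mul]
  change vol M * _ = _
  field_simp

end Morphing

/-! ### Dependence on time: regularity of the differentials and continuity of the outer normal. -/

namespace Morphing

variable {n : ℕ} {M N : Set (Ambient n)} {φ : Model n → Ambient n} {π : Ambient n → Model n}
  {U K : Set (Model n)} {F : ℝ → Ambient n → Ambient n}

theorem IsMorph.isDiffeo_one (hF : IsMorph 2 M N F) {t : ℝ} (ht : t ∈ Icc (0 : ℝ) 1) :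
    IsDiffeo 1 M (F t '' M) (F t) :=
  (hF.isDiffeo t ht).of_le (by norm_num)

/-- The spatial differential is the total derivative within `[0, 1] × U` composed with the inclusion
of the second factor, so exactly one order of regularity is lost, also at the endpoints of time. -/
theorem IsMorph.contDiffOn_fderiv (hF : IsMorph 2 M N F) (hφ : IsChart M φ π U) :
    ContDiffOn ℝ 1 (fun z : ℝ × Model n => fderiv ℝ (F z.1 ∘ φ) z.2) (Icc 0 1 ×ˢ U) := by
  set G : ℝ × Model n → Ambient n := fun z => F z.1 (φ z.2)
  have hG : ContDiffOn ℝ 2 G (Icc 0 1 ×ˢ U) := by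
    have h1 : ContDiffOn ℝ 2 (fun z : ℝ × Model n => (z.1, φ z.2)) (Icc 0 1 ×ˢ U) :=
      contDiffOn_fst.prodMk ((hφ.contDiffOn.of_le two_le_infty).comp contDiffOn_snd
        fun z hz => hz.2)
    exact hF.contDiffOn.comp h1 fun z hz => ⟨hz.1, hφ.mapsTo hz.2⟩
  have hud : UniqueDiffOn ℝ (Icc (0 : ℝ) 1 ×ˢ U) :=
    (uniqueDiffOn_Icc zero_lt_one).prod hφ.isOpen.uniqueDiffOn
  have h2 : ContDiffOn ℝ 1 (fun z => (fderivWithin ℝ G (Icc 0 1 ×ˢ U) z).comp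
      (ContinuousLinearMap.inr ℝ ℝ (Model n))) (Icc 0 1 ×ˢ U) :=
    (hG.fderivWithin hud (by norm_num : (1 : WithTop ℕ∞) + 1 ≤ 2)).clm_comp contDiffOn_const
  refine h2.congr fun z hz => HasFDerivAt.fderiv ?_
  have h3 := (hG.differentiableOn (by norm_num) z hz).hasFDerivWithinAt
  have h4 : HasFDerivAt (fun y : Model n => (z.1, y)) (ContinuousLinearMap.inr ℝ ℝ (Model n)) z.2 :=
    hasFDerivAt_prodMk_right z.1 z.2
  exact h3.comp_hasFDerivAt z.2 h4 (by
    filter_upwards [hφ.isOpen.mem_nhds hz.2] with y hy using ⟨hz.1, hy⟩)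

theorem IsMorph.contDiffOn_fderiv_left (hF : IsMorph 2 M N F) (hφ : IsChart M φ π U)
    {x : Model n} (hx : x ∈ U) :
    ContDiffOn ℝ 1 (fun t : ℝ => fderiv ℝ (F t ∘ φ) x) (Icc 0 1) :=
  (hF.contDiffOn_fderiv hφ).comp (contDiffOn_id.prodMk contDiffOn_const) fun _ ht => ⟨ht, hx⟩

theorem IsMorph.injective_fderiv (hF : IsMorph 2 M N F) (hφ : IsChart M φ π U) {t : ℝ}
    (ht : t ∈ Icc (0 : ℝ) 1) {x : Model n} (hx : x ∈ U) :
    Function.Injective (fderiv ℝ (F t ∘ φ) x) :=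
  ((hF.isDiffeo_one ht).isImmersionOn_comp hφ).injective_fderiv x hx

theorem IsMorph.inner_outerNormal_fderiv (hF : IsMorph 2 M N F) (hφ : IsChart M φ π U) {t : ℝ}
    (ht : t ∈ Icc (0 : ℝ) 1) {x : Model n} (hx : x ∈ U) (v : Model n) :
    inner ℝ (outerNormal (F t '' M) (F t (φ x))) (fderiv ℝ (F t ∘ φ) x v) = 0 := by
  have h := (hF.isDiffeo_one ht).isImmersionOn_comp hφ
  exact Morphing.inner_outerNormal_fderiv (hF.isClosedHypersurface t ht) h.isOpen
    (φ := F t ∘ φ) (fun y hy => mem_image_of_mem _ (hφ.mapsTo hy)) hx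
    ((h.contDiffOn.contDiffAt (h.isOpen.mem_nhds hx)).differentiableAt one_ne_zero) v

theorem IsMorph.contDiffOn_abs_morphJacobian (hF : IsMorph 2 M N F)
    (hM : IsClosedHypersurface M) {p : Ambient n} (hp : p ∈ M) :
    ContDiffOn ℝ 1 (fun t => |morphJacobian M F p t|) (Icc 0 1) := by
  obtain ⟨φ, π, U, x, hφ, hx, rfl⟩ := hM.exists_isChart hp
  have h1 : ContDiffOn ℝ 1
      (fun t => (fderiv ℝ (F t ∘ φ) x : Model n →ₗ[ℝ] Ambient n).normDet) (Icc 0 1) :=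
    fun t ht => ContDiffAt.comp_contDiffWithinAt
      (g := fun L : Model n →L[ℝ] Ambient n => (L : Model n →ₗ[ℝ] Ambient n).normDet)
      (f := fun t => fderiv ℝ (F t ∘ φ) x) t (contDiffAt_normDet (hF.injective_fderiv hφ ht hx))
      (hF.contDiffOn_fderiv_left hφ hx t ht)
  refine (h1.div_const (fderiv ℝ φ x : Model n →ₗ[ℝ] Ambient n).normDet).congr fun t ht => ?_
  exact (hF.isDiffeo_one ht).abs_jacobian_eq_div hM (hF.isClosedHypersurface t ht) hφ hx

theorem IsMorph.eventually_dist_lt (hF : IsMorph 2 M N F) (hM : IsClosedHypersurface M) {t₀ : ℝ}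
    (ht₀ : t₀ ∈ Icc (0 : ℝ) 1) {e : ℝ} (he : 0 < e) :
    ∀ᶠ t in 𝓝[Icc 0 1] t₀, ∀ q ∈ M, dist (F t q) (F t₀ q) < e := by
  have huc := (isCompact_Icc.prod hM.isCompact).uniformContinuousOn_of_continuous
    hF.contDiffOn.continuousOn
  obtain ⟨δ, hδ, h⟩ := Metric.uniformContinuousOn_iff.1 huc e he
  filter_upwards [inter_mem_nhdsWithin _ (Metric.ball_mem_nhds t₀ hδ)] with t ht q hq
  refine h (t, q) ⟨ht.1, hq⟩ (t₀, q) ⟨ht₀, hq⟩ ?_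
  rw [Prod.dist_eq, dist_self, max_lt_iff]
  exact ⟨ht.2, hδ⟩

/-- From `s / 2 ≤ η d` follows `l ≤ 4 η d`, hence `d ≤ 4 C η d = d / 2` and `d ≤ 0`, against `s >
0`. In the application `d = ‖y - x‖`, `l = ‖L (y - x)‖` and `i = ⟪ν, w⟫`. -/
theorem cone_estimate {s d η C i l : ℝ} (hs : 0 < s) (hC : 0 < C) (hη : 0 < η)
    (h : C * η = 1 / 8) (h1 : s * i ≤ η * d) (h2 : 1 / 2 ≤ i) (h3 : d ≤ C * l)
    (h4 : l ≤ s * (3 / 2) + η * d) : False := by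
  have h5 : s * (1 / 2) ≤ s * i := mul_le_mul_of_nonneg_left h2 hs.le
  have h6 : d ≤ C * (4 * (η * d)) :=
    h3.trans (mul_le_mul_of_nonneg_left (by linarith) hC.le)
  have h7 : C * (4 * (η * d)) = d / 2 := by linear_combination 4 * d * h
  have h8 : η * d ≤ 0 := mul_nonpos_of_nonneg_of_nonpos hη.le (by linarith)
  linarith

/-- Near `t₀`, a truncated cone about the outer normal at `F t₀ p` does not meet `M^t`. -/
theorem IsMorph.eventually_cone_notMem (hF : IsMorph 2 M N F) (hM : IsClosedHypersurface M)
    {t₀ : ℝ} (ht₀ : t₀ ∈ Icc (0 : ℝ) 1) {p : Ambient n} (hp : p ∈ M) :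
    ∃ δ > 0, ∀ᶠ t in 𝓝[Icc 0 1] t₀, ∀ s ∈ Ioc (0 : ℝ) δ, ∀ w : Ambient n,
      ‖w - outerNormal (F t₀ '' M) (F t₀ p)‖ ≤ 1 / 2 → F t p + s • w ∉ F t '' M := by
  obtain ⟨φ, π, U, x, hφ, hx, rfl⟩ := hM.exists_isChart hp
  set ν := outerNormal (F t₀ '' M) (F t₀ (φ x)) with hν
  have hν1 : ‖ν‖ = 1 := (outerNormal_spec (hF.isClosedHypersurface t₀ ht₀)
    (mem_image_of_mem _ hp)).norm_eq_one
  set L := fderiv ℝ (F t₀ ∘ φ) x with hL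
  have hνL : ∀ v, inner ℝ ν (L v) = 0 := hF.inner_outerNormal_fderiv hφ ht₀ hx
  obtain ⟨C, hC, hanti⟩ := (L : Model n →ₗ[ℝ] Ambient n).exists_antilipschitzWith
    (LinearMap.ker_eq_bot.2 (hF.injective_fderiv hφ ht₀ hx))
  have hC' : (0 : ℝ) < C := hC
  have hLC : ∀ v, ‖v‖ ≤ C * ‖L v‖ := fun v => by
    have := hanti.le_mul_dist v 0
    simpa [dist_eq_norm] using this
  set η : ℝ := 1 / (8 * C) with hη
  have hηpos : 0 < η := by positivity
  have hcont := ((hF.contDiffOn_fderiv hφ).continuousOn (t₀, x) ⟨ht₀, hx⟩)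
  have hev : ∀ᶠ z : ℝ × Model n in 𝓝[Icc 0 1 ×ˢ U] (t₀, x),
      ‖fderiv ℝ (F z.1 ∘ φ) z.2 - L‖ < η := by
    have := hcont (Metric.ball_mem_nhds _ hηpos)
    filter_upwards [this] with z hz
    rw [← dist_eq_norm]
    exact hz
  rw [nhdsWithin_prod_eq, hφ.isOpen.nhdsWithin_eq hx] at hev
  obtain ⟨P, hP, Q, hQ, hPQ⟩ := eventually_prod_iff.1 hev
  obtain ⟨r, hr, hrs⟩ := Metric.nhds_basis_ball.mem_iff.1 (hQ.and (hφ.isOpen.mem_nhds hx))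
  have hbU : Metric.ball x r ⊆ U := fun y hy => (hrs hy).2
  have hball := hφ.restrict Metric.isOpen_ball hbU
  obtain ⟨W, hW, hUW⟩ := hball.exists_isOpen
  have hpW : φ x ∈ W := (hUW.subset (mem_image_of_mem φ (Metric.mem_ball_self hr))).2
  have hQc : IsCompact (M \ W) := hM.isCompact.diff hW
  obtain ⟨m, hm, hmin⟩ : ∃ m > 0, ∀ q ∈ M \ W, m ≤ dist (F t₀ q) (F t₀ (φ x)) := by
    rcases (M \ W).eq_empty_or_nonempty with h | h
    · exact ⟨1, one_pos, by simp [h]⟩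
    obtain ⟨q, hq, hqm⟩ := hQc.exists_isMinOn h
      (f := fun q => dist (F t₀ q) (F t₀ (φ x)))
      (continuous_dist.comp_continuousOn
        (((hF.isDiffeo t₀ ht₀).1.continuousOn.mono sdiff_subset).prodMk continuousOn_const))
    have hne : F t₀ q ≠ F t₀ (φ x) := fun heq => ?_
    · exact ⟨dist (F t₀ q) (F t₀ (φ x)), dist_pos.2 hne, fun q' hq' => isMinOn_iff.1 hqm q' hq'⟩
    refine hq.2 ?_
    rw [(hF.isDiffeo t₀ ht₀).injOn hq.1 hp heq]
    exact hpW
  -- Points of `M` outside the chart patch have image at distance at least `m` from that of the base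
  -- point at time `t₀`. Two motions of less than `m / 4` and a displacement of at most `(3/2)(m/4)`
  -- cannot bridge this.
  refine ⟨m / 4, by positivity, ?_⟩
  filter_upwards [hP, self_mem_nhdsWithin,
    hF.eventually_dist_lt hM ht₀ (by positivity : 0 < m / 4)] with t htP ht htd
  rintro s ⟨hs0, hsδ⟩ w hw ⟨q, hq, hqe⟩
  have hw1 : ‖w‖ ≤ 3 / 2 := by
    have := norm_add_le (w - ν) ν
    rw [sub_add_cancel, hν1] at this
    linarith
  have hnorm : ‖s • w‖ ≤ s * (3 / 2) := by
    rw [norm_smul, Real.norm_of_nonneg hs0.le]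
    exact mul_le_mul_of_nonneg_left hw1 hs0.le
  by_cases hqW : q ∈ W
  · obtain ⟨y, hy, rfl⟩ := hUW.superset ⟨hq, hqW⟩
    have himm := (hF.isDiffeo_one ht).isImmersionOn_comp hφ
    -- Within the patch a chord of `M^t` is within `η d` of a tangent vector at time `t₀`, hence
    -- almost orthogonal to `ν`, whereas a cone direction satisfies `⟪ν, w⟫ ≥ 1/2`.
    have hmv := (convex_ball x r).norm_image_sub_le_of_norm_hasFDerivWithin_le'
      (f := F t ∘ φ) (f' := fderiv ℝ (F t ∘ φ)) (φ := L) (C := η)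
      (fun z hz => ((himm.contDiffOn.contDiffAt
        (hφ.isOpen.mem_nhds (hbU hz))).differentiableAt one_ne_zero).hasFDerivAt.hasFDerivWithinAt)
      (fun z hz => (hPQ htP (hrs hz).1).le) (Metric.mem_ball_self hr) hy
    have hdiff : (F t ∘ φ) y - (F t ∘ φ) x = s • w := by
      simp only [Function.comp_apply, hqe]
      abel
    rw [hdiff] at hmv
    set d := ‖y - x‖ with hd
    have h1 : s * inner ℝ ν w ≤ η * d := by
      have h2 : inner ℝ ν (s • w - L (y - x)) = s * inner ℝ ν w := by
        rw [inner_sub_right, hνL, inner_smul_right, sub_zero]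
      rw [← h2]
      refine (real_inner_le_norm _ _).trans ?_
      rw [hν1, one_mul]
      exact hmv
    have h3 : 1 / 2 ≤ inner ℝ ν w := by
      have h4 : inner ℝ ν w = 1 + inner ℝ ν (w - ν) := by
        rw [inner_sub_right, real_inner_self_eq_norm_sq, hν1]
        ring
      have h5 := neg_le_of_abs_le (abs_real_inner_le_norm ν (w - ν))
      rw [hν1, one_mul] at h5
      linarith
    have h6 : ‖L (y - x)‖ ≤ s * (3 / 2) + η * d := by
      have := norm_sub_norm_le (L (y - x)) (s • w)
      rw [norm_sub_rev] at this
      linarith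
    have h8 : C * η = 1 / 8 := by
      rw [hη]
      field_simp
    exact cone_estimate hs0 hC' hηpos h8 h1 h3 (hLC (y - x)) h6
  · have h1 := hmin q ⟨hq, hqW⟩
    have h2 := htd q hq
    have h3 := htd (φ x) hp
    have h4 : dist (F t q) (F t (φ x)) ≤ s * (3 / 2) := by
      rw [hqe, dist_eq_norm, add_sub_cancel_left]
      exact hnorm
    have h5 := dist_triangle4 (F t₀ q) (F t q) (F t (φ x)) (F t₀ (φ x))
    rw [dist_comm (F t₀ q) (F t q)] at h5
    linarith

theorem IsMorph.exists_norm_le (hF : IsMorph 2 M N F) (hM : IsClosedHypersurface M) :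
    ∃ R : ℝ, ∀ t ∈ Icc (0 : ℝ) 1, ∀ q ∈ M, ‖F t q‖ ≤ R := by
  obtain ⟨R, hR⟩ := (isCompact_Icc.prod hM.isCompact).exists_bound_of_continuousOn
    hF.contDiffOn.continuousOn
  exact ⟨R, fun t ht q hq => hR (t, q) ⟨ht, hq⟩⟩

/-- Points of the exterior of `M^{t₀}` are exterior to the nearby hypersurfaces, uniformly. -/
theorem IsMorph.eventually_mem_exterior (hF : IsMorph 2 M N F) (hM : IsClosedHypersurface M)
    {t₀ : ℝ} (ht₀ : t₀ ∈ Icc (0 : ℝ) 1) {z₀ : Ambient n} (hz₀ : z₀ ∈ exterior (F t₀ '' M)) :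
    ∃ e > 0, ∀ᶠ t in 𝓝[Icc 0 1] t₀, ∀ z, dist z z₀ < e → z ∈ exterior (F t '' M) := by
  have hK := (hF.isClosedHypersurface t₀ ht₀).isCompact
  obtain ⟨R, hR⟩ := hF.exists_norm_le hM
  obtain ⟨q₀, hq₀⟩ := hM.isConnected.nonempty
  have hR0 : 0 ≤ R := (norm_nonneg _).trans (hR t₀ ht₀ q₀ hq₀)
  have hz₀' : ¬ Bornology.IsBounded (connectedComponentIn (F t₀ '' M)ᶜ z₀) := hz₀
  have hz₀c : z₀ ∈ (F t₀ '' M)ᶜ := by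
    by_contra hn
    rw [connectedComponentIn_eq_empty hn] at hz₀'
    exact hz₀' Bornology.isBounded_empty
  have hopen : IsOpen (connectedComponentIn (F t₀ '' M)ᶜ z₀) :=
    hK.isClosed.isOpen_compl.connectedComponentIn
  have hconn : IsConnected (connectedComponentIn (F t₀ '' M)ᶜ z₀) :=
    isConnected_connectedComponentIn_iff.2 hz₀c
  -- The ball of radius `R` contains every `M^t`, so from `w` one can escape to infinity radially at
  -- all times.
  obtain ⟨w, hw, hwR⟩ : ∃ w ∈ connectedComponentIn (F t₀ '' M)ᶜ z₀, R < ‖w‖ := by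
    by_contra! hn
    exact hz₀' ((Metric.isBounded_closedBall (x := 0) (r := R)).subset fun w hw => by
      simpa using hn w hw)
  obtain ⟨γ, hγ⟩ := (hopen.isConnected_iff_isPathConnected.1 hconn).joinedIn z₀
    (mem_connectedComponentIn hz₀c) w hw
  have hγK : ∀ τ, γ τ ∉ F t₀ '' M := fun τ => connectedComponentIn_subset _ _ (hγ τ)
  have hrange : IsCompact (range γ) := isCompact_range γ.continuous
  obtain ⟨e, he, hdist⟩ : ∃ e > 0, ∀ y ∈ range γ, ∀ q ∈ M, e ≤ dist y (F t₀ q) := by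
    obtain ⟨⟨y, k⟩, hyk, hmin⟩ := (hrange.prod hK).exists_isMinOn
      (f := fun z : Ambient n × Ambient n => dist z.1 z.2)
      ⟨(γ 0, F t₀ q₀), mem_range_self _, mem_image_of_mem _ hq₀⟩ continuous_dist.continuousOn
    refine ⟨dist y k, dist_pos.2 ?_, fun y' hy' q hq => ?_⟩
    · rintro rfl
      obtain ⟨τ, hτ⟩ := hyk.1
      exact hγK τ (hτ ▸ hyk.2)
    · exact isMinOn_iff.1 hmin (y', F t₀ q) ⟨hy', mem_image_of_mem _ hq⟩
  have hγ0 : z₀ ∈ range γ := ⟨0, γ.source⟩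
  have hγ1 : w ∈ range γ := ⟨1, γ.target⟩
  refine ⟨e / 2, by positivity, ?_⟩
  filter_upwards [self_mem_nhdsWithin, hF.eventually_dist_lt hM ht₀ (half_pos he)]
    with t ht htd z hz
  let ray : Set (Ambient n) := (fun r : ℝ => r • w) '' Ici 1
  -- A connected unbounded set avoiding `M^t`: the ball and the path have room because `M^{t₀}`
  -- stays at distance `e` from the path and moves by less than `e / 2`.
  let T : Set (Ambient n) := (Metric.ball z₀ (e / 2) ∪ range γ) ∪ ray
  have hray : IsPreconnected ray :=
    isPreconnected_Ici.image _ (by fun_prop : Continuous fun r : ℝ => r • w).continuousOn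
  have hT : IsPreconnected T := by
    refine IsPreconnected.union w (Or.inr hγ1) ⟨1, self_mem_Ici, one_smul _ _⟩ ?_ hray
    exact IsPreconnected.union z₀ (Metric.mem_ball_self (half_pos he)) hγ0
      (convex_ball _ _).isPreconnected (isPreconnected_range γ.continuous)
  have hTc : T ⊆ (F t '' M)ᶜ := by
    rintro y hy ⟨q, hq, rfl⟩
    have h2 := htd q hq
    rcases hy with (hy | hy) | ⟨r, hr, hre⟩
    · have h1 := hdist z₀ hγ0 q hq
      have h3 := dist_triangle z₀ (F t q) (F t₀ q)
      rw [Metric.mem_ball, dist_comm] at hy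
      linarith
    · have h1 := hdist _ hy q hq
      linarith
    · have h1 := hR t ht q hq
      have hr' : (1 : ℝ) ≤ r := hr
      simp only at hre
      rw [← hre, norm_smul, Real.norm_of_nonneg (by linarith)] at h1
      nlinarith
  have hzT : z ∈ T := Or.inl (Or.inl hz)
  have hsub := hT.subset_connectedComponentIn hzT hTc
  intro hb
  obtain ⟨B, hB⟩ := isBounded_iff_forall_norm_le.1 (hb.subset hsub)
  have hwpos : 0 < ‖w‖ := hR0.trans_lt hwR
  have hB0 : 0 ≤ B := (norm_nonneg _).trans (hB z hzT)
  have h1 := hB ((B / ‖w‖ + 1) • w)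
    (Or.inr ⟨_, by simp only [mem_Ici]; have := div_nonneg hB0 hwpos.le; linarith, rfl⟩)
  rw [norm_smul, Real.norm_of_nonneg (by positivity), add_mul, div_mul_cancel₀ _ hwpos.ne'] at h1
  linarith

/-- This excludes a flip of the normal. If the outer normal `μ` of `M^t` were within `1/2` of `-ν`,
the point `F t p - σ • μ` and the exterior point `F t p + s • ν` would lie in one connected cone
disjoint from `M^t`. Then `F t p - σ • μ` would be exterior too, contrary to the definition of the
outer normal. -/
theorem IsMorph.eventually_norm_add_outerNormal (hF : IsMorph 2 M N F)
    (hM : IsClosedHypersurface M) {t₀ : ℝ} (ht₀ : t₀ ∈ Icc (0 : ℝ) 1) {p : Ambient n}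
    (hp : p ∈ M) : ∀ᶠ t in 𝓝[Icc 0 1] t₀, 1 / 2 <
      ‖outerNormal (F t '' M) (F t p) + outerNormal (F t₀ '' M) (F t₀ p)‖ := by
  obtain ⟨δ, hδ, hcone⟩ := hF.eventually_cone_notMem hM ht₀ hp
  set ν := outerNormal (F t₀ '' M) (F t₀ p) with hν
  have hspec := outerNormal_spec (hF.isClosedHypersurface t₀ ht₀) (mem_image_of_mem (F t₀) hp)
  obtain ⟨s, hs, hsd⟩ := (hspec.outward.and (Ioc_mem_nhdsGT hδ)).exists
  obtain ⟨e, he, hext⟩ := hF.eventually_mem_exterior hM ht₀ hs.1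
  filter_upwards [self_mem_nhdsWithin, hcone, hext, hF.eventually_dist_lt hM ht₀ he]
    with t ht hcone hext htd
  by_contra! hn
  set μ := outerNormal (F t '' M) (F t p) with hμ
  have hspect := outerNormal_spec (hF.isClosedHypersurface t ht) (mem_image_of_mem (F t) hp)
  obtain ⟨σ, hσ, hσd⟩ := (hspect.outward.and (Ioc_mem_nhdsGT hδ)).exists
  let T : Set (Ambient n) := (fun z : ℝ × Ambient n => F t p + z.1 • z.2) ''
    (Ioc 0 δ ×ˢ Metric.closedBall ν (1 / 2))
  have hT : IsPreconnected T :=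
    (isPreconnected_Ioc.prod (convex_closedBall _ _).isPreconnected).image _
      (by fun_prop : Continuous fun z : ℝ × Ambient n => F t p + z.1 • z.2).continuousOn
  have hTc : T ⊆ (F t '' M)ᶜ := by
    rintro _ ⟨⟨a, w⟩, ⟨ha, hw⟩, rfl⟩
    refine hcone a ha w ?_
    rwa [← dist_eq_norm]
  have h1 : F t p + s • ν ∈ T := ⟨(s, ν), ⟨hsd, Metric.mem_closedBall_self (by norm_num)⟩, rfl⟩
  have h2 : F t p - σ • μ ∈ T := by
    refine ⟨(σ, -μ), ⟨hσd, ?_⟩, by simp [sub_eq_add_neg]⟩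
    rw [Metric.mem_closedBall, dist_eq_norm, ← norm_neg]
    simpa [add_comm] using hn
  have h3 : F t p + s • ν ∈ exterior (F t '' M) := hext _ (by
    rw [dist_add_right]
    exact htd p hp)
  refine hσ.2 ?_
  have h4 : connectedComponentIn (F t '' M)ᶜ (F t p + s • ν) =
      connectedComponentIn (F t '' M)ᶜ (F t p - σ • μ) :=
    connectedComponentIn_eq (hT.subset_connectedComponentIn h1 hTc h2)
  change ¬ Bornology.IsBounded _
  rw [← h4]
  exact h3

theorem exists_eq_of_inner_eq_zero {L : Model n →L[ℝ] Ambient n} (hL : Function.Injective L)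
    {ν : Ambient n} (hν : ‖ν‖ = 1) (hνL : ∀ v, inner ℝ ν (L v) = 0) {τ : Ambient n}
    (hτ : inner ℝ ν τ = 0) : ∃ v, L v = τ := by
  have hle : LinearMap.range (L : Model n →ₗ[ℝ] Ambient n) ≤ (ℝ ∙ ν)ᗮ := by
    rintro _ ⟨v, rfl⟩
    exact Submodule.mem_orthogonal_singleton_iff_inner_right.2 (hνL v)
  have hν0 : ν ≠ 0 := fun h => by simp [h] at hν
  have h1 : Module.finrank ℝ (LinearMap.range (L : Model n →ₗ[ℝ] Ambient n)) = n := by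
    rw [LinearMap.finrank_range_of_inj hL]
    simp
  have : Fact (Module.finrank ℝ (Ambient n) = n + 1) := ⟨by simp⟩
  have h2 : Module.finrank ℝ (ℝ ∙ ν)ᗮ = n := Submodule.finrank_orthogonal_span_singleton hν0
  have heq := Submodule.eq_of_le_of_finrank_eq hle (h1.trans h2.symm)
  have hmem : τ ∈ (ℝ ∙ ν)ᗮ := Submodule.mem_orthogonal_singleton_iff_inner_right.2 hτ
  rw [← heq] at hmem
  exact hmem

/-- The component `τ` of `μ` orthogonal to `ν` is tangent to `M^{t₀}`, say `τ = L t₀ v`. As `μ` is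
orthogonal to `L t v`, `‖τ‖² = ⟪μ, (L t₀ - L t) v⟫`, which forces `τ → 0`. So `μ` approaches `ν` or
`-ν`, and the latter is excluded by `IsMorph.eventually_norm_add_outerNormal`. -/
theorem IsMorph.tendsto_outerNormal (hF : IsMorph 2 M N F) (hM : IsClosedHypersurface M)
    {t₀ : ℝ} (ht₀ : t₀ ∈ Icc (0 : ℝ) 1) {p : Ambient n} (hp : p ∈ M) :
    Tendsto (fun t => outerNormal (F t '' M) (F t p)) (𝓝[Icc 0 1] t₀)
      (𝓝 (outerNormal (F t₀ '' M) (F t₀ p))) := by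
  have hadd := hF.eventually_norm_add_outerNormal hM ht₀ hp
  obtain ⟨φ, π, U, x, hφ, hx, rfl⟩ := hM.exists_isChart hp
  set ν := outerNormal (F t₀ '' M) (F t₀ (φ x)) with hν
  have hν1 : ‖ν‖ = 1 := (outerNormal_spec (hF.isClosedHypersurface t₀ ht₀)
    (mem_image_of_mem _ hp)).norm_eq_one
  set L : ℝ → Model n →L[ℝ] Ambient n := fun t => fderiv ℝ (F t ∘ φ) x with hL
  have hinj := hF.injective_fderiv hφ ht₀ hx
  have hνL : ∀ v, inner ℝ ν (L t₀ v) = 0 := hF.inner_outerNormal_fderiv hφ ht₀ hx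
  obtain ⟨C, hC, hanti⟩ := (L t₀ : Model n →ₗ[ℝ] Ambient n).exists_antilipschitzWith
    (LinearMap.ker_eq_bot.2 hinj)
  have hLC : ∀ v, ‖v‖ ≤ C * ‖L t₀ v‖ := fun v => by
    have := hanti.le_mul_dist v 0
    simpa [dist_eq_norm] using this
  have hLt : Tendsto (fun t => 4 * (‖L t₀ - L t‖ * C)) (𝓝[Icc 0 1] t₀) (𝓝 0) := by
    have h1 : Tendsto L (𝓝[Icc 0 1] t₀) (𝓝 (L t₀)) :=
      (hF.contDiffOn_fderiv_left hφ hx).continuousOn t₀ ht₀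
    have h2 := ((tendsto_const_nhds (x := L t₀)).sub h1).norm
    simpa using (h2.mul_const (C : ℝ)).const_mul 4
  rw [tendsto_iff_norm_sub_tendsto_zero]
  refine squeeze_zero' (Eventually.of_forall fun t => norm_nonneg _) ?_ hLt
  filter_upwards [hadd, self_mem_nhdsWithin] with t hadd ht
  set μ := outerNormal (F t '' M) (F t (φ x)) with hμ
  have hμ1 : ‖μ‖ = 1 := (outerNormal_spec (hF.isClosedHypersurface t ht)
    (mem_image_of_mem _ hp)).norm_eq_one
  have hμL : ∀ v, inner ℝ μ (L t v) = 0 := hF.inner_outerNormal_fderiv hφ ht hx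
  set c : ℝ := inner ℝ ν μ with hc
  set τ := μ - c • ν with hτ
  have hντ : inner ℝ ν τ = 0 := by
    rw [hτ, inner_sub_right, inner_smul_right, real_inner_self_eq_norm_sq, hν1]
    ring
  obtain ⟨v, hv⟩ := exists_eq_of_inner_eq_zero hinj hν1 hνL hντ
  have hv' : L t₀ v = τ := hv
  have hμτ : inner ℝ μ τ = ‖τ‖ ^ 2 := by
    have : μ = τ + c • ν := by rw [hτ]; abel
    conv_lhs => rw [this]
    rw [inner_add_left, real_inner_self_eq_norm_sq, inner_smul_left, hντ]
    simp
  have hτ2 : ‖τ‖ ^ 2 = 1 - c ^ 2 := by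
    rw [← hμτ, hτ, inner_sub_right, real_inner_self_eq_norm_sq, hμ1, inner_smul_right,
      real_inner_comm]
    ring
  have hτle : ‖τ‖ ^ 2 ≤ ‖L t₀ - L t‖ * C * ‖τ‖ := by
    have h1 : inner ℝ μ τ = inner ℝ μ ((L t₀ - L t) v) := by
      have e := inner_sub_right (𝕜 := ℝ) μ (L t₀ v) (L t v)
      rw [hμL v, hv', sub_zero] at e
      exact e.symm.trans (by rw [← hv']; rfl)
    rw [← hμτ, h1]
    refine (real_inner_le_norm _ _).trans ?_
    rw [hμ1, one_mul]
    refine ((L t₀ - L t).le_opNorm v).trans ?_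
    have h2 := hLC v
    rw [hv'] at h2
    calc _ ≤ ‖L t₀ - L t‖ * (C * ‖τ‖) := mul_le_mul_of_nonneg_left h2 (norm_nonneg _)
      _ = _ := by ring
  have hτle' : ‖τ‖ ≤ ‖L t₀ - L t‖ * C := by
    rcases (norm_nonneg τ).eq_or_lt with h | h
    · rw [← h]
      positivity
    · rw [sq] at hτle
      exact le_of_mul_le_mul_right hτle h
  have hs1 : ‖μ + ν‖ ^ 2 = 2 + 2 * c := by
    rw [norm_add_sq_real, hμ1, hν1, real_inner_comm]
    ring
  have hs2 : ‖μ - ν‖ ^ 2 = 2 - 2 * c := by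
    rw [norm_sub_sq_real, hμ1, hν1, real_inner_comm]
    ring
  -- For unit vectors `4 ‖τ‖² = ‖μ - ν‖² ‖μ + ν‖²`, and `‖μ + ν‖² ≥ 1/4`.
  have hle : ‖μ - ν‖ ≤ 4 * ‖τ‖ := by
    refine le_of_sq_le_sq ?_ (by positivity)
    have h4 : (1 / 4 : ℝ) ≤ 2 + 2 * c := by
      rw [← hs1]
      nlinarith
    have h5 : 0 ≤ 2 - 2 * c := hs2 ▸ sq_nonneg _
    rw [mul_pow, hτ2, hs2]
    nlinarith
  linarith

end Morphing

/-! ### Sign of the Jacobian and the distortion of pairwise minimal morphs. -/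

namespace Morphing

variable {n : ℕ} {M N : Set (Ambient n)} {φ : Model n → Ambient n} {π : Ambient n → Model n}
  {U : Set (Model n)} {F : ℝ → Ambient n → Ambient n}

theorem continuous_ambientForm : Continuous fun v : Fin (n + 1) → Ambient n => ambientForm n v := by
  simp only [ambientForm, Module.Basis.det_apply]
  refine Continuous.matrix_det (continuous_matrix fun i j => ?_)
  simp only [Module.Basis.toMatrix_apply, OrthonormalBasis.coe_toBasis_repr_apply,
    EuclideanSpace.basisFun_repr]
  fun_prop

theorem IsMorph.morphJacobian_mul (hF : IsMorph 2 M N F) (hM : IsClosedHypersurface M)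
    (hφ : IsChart M φ π U) {x : Model n} (hx : x ∈ U) {t : ℝ} (ht : t ∈ Icc (0 : ℝ) 1) :
    ambientForm n (Matrix.vecCons (outerNormal (F t '' M) (F t (φ x)))
        (frame (fderiv ℝ (F t ∘ φ) x))) =
      morphJacobian M F (φ x) t * volumeForm M (φ x) (frame (fderiv ℝ φ x)) :=
  volumeForm_frame_comp hM hφ.isOpen hφ.mapsTo hx (hφ.differentiableAt hx)
    ((hF.isDiffeo_one ht).differentiableWithinAt (hφ.mapsTo hx))

theorem IsChart.volumeForm_frame_ne_zero (hφ : IsChart M φ π U) (hM : IsClosedHypersurface M)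
    {x : Model n} (hx : x ∈ U) : volumeForm M (φ x) (frame (fderiv ℝ φ x)) ≠ 0 := by
  rw [← abs_pos, volumeForm_frame_abs hM (hφ.mapsTo hx)
    (inner_outerNormal_fderiv hM hφ.isOpen hφ.mapsTo hx (hφ.differentiableAt hx))]
  exact hφ.normDet_pos hx

/-- In a chart the signed Jacobian is the ambient determinant of the moving normal and frame over a
nonzero constant; both normal and frame converge. -/
theorem IsMorph.continuousOn_morphJacobian (hF : IsMorph 2 M N F) (hM : IsClosedHypersurface M)
    {p : Ambient n} (hp : p ∈ M) : ContinuousOn (morphJacobian M F p) (Icc 0 1) := by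
  intro t₀ ht₀
  have hν := hF.tendsto_outerNormal hM ht₀ hp
  obtain ⟨φ, π, U, x, hφ, hx, rfl⟩ := hM.exists_isChart hp
  have hL : Tendsto (fun t => fderiv ℝ (F t ∘ φ) x) (𝓝[Icc 0 1] t₀)
      (𝓝 (fderiv ℝ (F t₀ ∘ φ) x)) := (hF.contDiffOn_fderiv_left hφ hx).continuousOn t₀ ht₀
  have h1 : Tendsto (fun t => Matrix.vecCons (outerNormal (F t '' M) (F t (φ x)))
      (frame (fderiv ℝ (F t ∘ φ) x))) (𝓝[Icc 0 1] t₀)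
      (𝓝 (Matrix.vecCons (outerNormal (F t₀ '' M) (F t₀ (φ x)))
        (frame (fderiv ℝ (F t₀ ∘ φ) x)))) := by
    refine tendsto_pi_nhds.2 fun i => ?_
    refine Fin.cases hν (fun j => ?_) i
    exact ((ContinuousLinearMap.apply ℝ (Ambient n)
      (EuclideanSpace.basisFun (Fin n) ℝ j)).continuous.tendsto _).comp hL
  have h2 := (continuous_ambientForm.tendsto _).comp h1
  have hne := hφ.volumeForm_frame_ne_zero hM hx
  have h3 := h2.div_const (volumeForm M (φ x) (frame (fderiv ℝ φ x)))
  have h4 : ∀ t ∈ Icc (0 : ℝ) 1, ambientForm n (Matrix.vecCons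
      (outerNormal (F t '' M) (F t (φ x))) (frame (fderiv ℝ (F t ∘ φ) x))) /
      volumeForm M (φ x) (frame (fderiv ℝ φ x)) = morphJacobian M F (φ x) t := fun t ht => by
    rw [hF.morphJacobian_mul hM hφ hx ht, mul_div_cancel_right₀ _ hne]
  rw [h4 t₀ ht₀] at h3
  refine h3.congr' ?_
  filter_upwards [self_mem_nhdsWithin] with t ht using h4 t ht

theorem IsMorph.image_zero (hF : IsMorph 2 M N F) : F 0 '' M = M := by
  rw [image_congr hF.start_eq, image_id']

theorem IsMorph.morphJacobian_zero (hF : IsMorph 2 M N F) (hM : IsClosedHypersurface M)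
    {p : Ambient n} (hp : p ∈ M) : morphJacobian M F p 0 = 1 := by
  obtain ⟨φ, π, U, x, hφ, hx, rfl⟩ := hM.exists_isChart hp
  have hne := hφ.volumeForm_frame_ne_zero hM hx
  have h := hF.morphJacobian_mul hM hφ hx (left_mem_Icc.2 zero_le_one)
  have hev : F 0 ∘ φ =ᶠ[𝓝 x] φ := by
    filter_upwards [hφ.isOpen.mem_nhds hx] with y hy using hF.start_eq _ (hφ.mapsTo hy)
  rw [hF.image_zero, hF.start_eq _ hp, hev.fderiv_eq] at h
  exact mul_right_cancel₀ hne (h.symm.trans (one_mul _).symm)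

/-- Intermediate value theorem: the Jacobian starts at `1` and cannot vanish, each `F t` being a
diffeomorphism. -/
theorem IsMorph.morphJacobian_pos (hF : IsMorph 2 M N F) (hM : IsClosedHypersurface M)
    {p : Ambient n} (hp : p ∈ M) {t : ℝ} (ht : t ∈ Icc (0 : ℝ) 1) :
    0 < morphJacobian M F p t := by
  by_contra! hn
  have h0 : (0 : ℝ) ∈ Icc (0 : ℝ) 1 := left_mem_Icc.2 zero_le_one
  have h1 := isPreconnected_Icc.intermediate_value ht h0 (hF.continuousOn_morphJacobian hM hp)
  obtain ⟨τ, hτ, hz⟩ := h1 ⟨hn, by rw [hF.morphJacobian_zero hM hp]; exact zero_le_one⟩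
  have h2 : 0 < |morphJacobian M F p τ| :=
    (hF.isDiffeo_one hτ).abs_jacobian_pos hM (hF.isClosedHypersurface τ hτ) hp
  rw [hz, abs_zero] at h2
  exact h2.false

/-- Supplies the `C^2` regularity that pairwise minimality does not give when `k = 1`. On the image,
the chosen inverse agrees with the `C^2` inverse of `F s`. -/
theorem IsMorph.isDiffeo_transition (hF : IsMorph 2 M N F) {s t : ℝ} (hs : s ∈ Icc (0 : ℝ) 1)
    (ht : t ∈ Icc (0 : ℝ) 1) : IsDiffeo 2 (F s '' M) (F t '' M) (transition M F s t) := by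
  have hinj := (hF.isDiffeo s hs).injOn
  have h1 : IsDiffeo 2 (F s '' M) M (Function.invFunOn (F s) M) := by
    obtain ⟨f1, f2, g, g1, g2, g3⟩ := hF.isDiffeo s hs
    have heq : EqOn (Function.invFunOn (F s) M) g (F s '' M) := by
      rintro _ ⟨p, hp, rfl⟩
      rw [hinj.leftInvOn_invFunOn hp, g3.1 hp]
    refine ⟨g1.congr heq, g2.congr heq.symm, F s, f1, f2, ?_, hinj.leftInvOn_invFunOn⟩
    intro q hq
    rw [heq hq]
    exact g3.2 hq
  exact (hF.isDiffeo t ht).comp h1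

section PairwiseMinimal

variable {k : ℕ∞}

theorem IsMorph.transitionEnergy_eq (hF : IsMorph 2 M N F) (hk : 1 ≤ k)
    (hmin : IsPairwiseMinimal k M F) {s t : ℝ} (hs : s ∈ Icc (0 : ℝ) 1) (ht : t ∈ Icc (0 : ℝ) 1) :
    transitionEnergy M F s t =
      (vol (F t '' M) - vol (F s '' M)) ^ 2 / vol (F s '' M) :=
  stretchEnergy_eq_of_isMin (hF.isClosedHypersurface s hs) (hF.isClosedHypersurface t ht) hk
    (hmin s hs t ht).1 (hF.isDiffeo_transition hs ht) (hmin s hs t ht).2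

/-- Minimality is used only for the pair `(0, t)`, where the transition map is `F t` on `M`;
positivity then removes the absolute value. -/
theorem IsMorph.morphJacobian_eq (hF : IsMorph 2 M N F) (hM : IsClosedHypersurface M)
    (hk : 1 ≤ k) (hmin : IsPairwiseMinimal k M F) {p : Ambient n} (hp : p ∈ M) {t : ℝ}
    (ht : t ∈ Icc (0 : ℝ) 1) : morphJacobian M F p t = vol (F t '' M) / vol M := by
  have h0 : (0 : ℝ) ∈ Icc (0 : ℝ) 1 := left_mem_Icc.2 zero_le_one
  have heq : EqOn (transition M F 0 t) (F t) M := fun q hq => by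
    have h1 := (hF.isDiffeo 0 h0).injOn.leftInvOn_invFunOn hq
    rw [hF.start_eq q hq] at h1
    rw [transition, Function.comp_apply, h1]
  have h1 := abs_jacobian_eq_vol_div (hF.isClosedHypersurface 0 h0)
    (hF.isClosedHypersurface t ht) hk (hmin 0 h0 t ht).1 (hF.isDiffeo_transition h0 ht)
    (hmin 0 h0 t ht).2 (p := p) (by rwa [hF.image_zero])
  rw [hF.image_zero, jacobian_congr (heq.eventuallyEq_nhdsWithin) (heq hp)] at h1
  rw [← h1, morphJacobian, abs_of_pos]
  exact hF.morphJacobian_pos hM hp ht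

/-- The Jacobian being constant on `M`, the volume is `vol M` times its value at a single point; no
differentiation under the integral is needed. -/
theorem IsMorph.contDiffOn_vol (hF : IsMorph 2 M N F) (hM : IsClosedHypersurface M)
    (hk : 1 ≤ k) (hmin : IsPairwiseMinimal k M F) :
    ContDiffOn ℝ 1 (fun t => vol (F t '' M)) (Icc 0 1) := by
  obtain ⟨p, hp⟩ := hM.isConnected.nonempty
  refine ((hF.contDiffOn_abs_morphJacobian hM hp).mul
    (contDiffOn_const (c := vol M))).congr fun t ht => ?_
  rw [hF.morphJacobian_eq hM hk hmin hp ht, abs_of_pos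
    (div_pos (hF.isClosedHypersurface t ht).vol_pos hM.vol_pos),
    div_mul_cancel₀ _ hM.vol_pos.ne']

theorem IsMorph.tendsto_transitionEnergy_div (hF : IsMorph 2 M N F) (hM : IsClosedHypersurface M)
    (hk : 1 ≤ k) (hmin : IsPairwiseMinimal k M F) {t : ℝ} (ht : t ∈ Icc (0 : ℝ) 1) :
    Tendsto (fun s => transitionEnergy M F s t / (s - t) ^ 2) (𝓝[Icc 0 1 \ {t}] t)
      (𝓝 ((derivWithin (fun τ => vol (F τ '' M)) (Icc 0 1) t) ^ 2 / vol (F t '' M))) := by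
  set V : ℝ → ℝ := fun τ => vol (F τ '' M) with hV
  have hVc := hF.contDiffOn_vol hM hk hmin
  have hd := (hVc.differentiableOn one_ne_zero t ht).hasDerivWithinAt
  have h1 := hasDerivWithinAt_iff_tendsto_slope.1 hd
  have h2 : Tendsto V (𝓝[Icc 0 1 \ {t}] t) (𝓝 (V t)) :=
    (hVc.continuousOn t ht).mono_left (nhdsWithin_mono _ sdiff_subset)
  have hpos : 0 < V t := (hF.isClosedHypersurface t ht).vol_pos
  refine ((h1.pow 2).div h2 hpos.ne').congr' ?_
  filter_upwards [self_mem_nhdsWithin] with s hs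
  have hst : s - t ≠ 0 := sub_ne_zero.2 hs.2
  have hVs : V s ≠ 0 := (hF.isClosedHypersurface s hs.1).vol_pos.ne'
  rw [hF.transitionEnergy_eq hk hmin hs.1 ht]
  change slope V t s ^ 2 / V s = (V t - V s) ^ 2 / V s / (s - t) ^ 2
  rw [slope_def_field]
  field_simp
  ring

theorem IsMorph.infinitesimalDistortion_eq (hF : IsMorph 2 M N F) (hM : IsClosedHypersurface M)
    (hk : 1 ≤ k) (hmin : IsPairwiseMinimal k M F) {t : ℝ} (ht : t ∈ Icc (0 : ℝ) 1) :
    infinitesimalDistortion M F t =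
      (derivWithin (fun τ => vol (F τ '' M)) (Icc 0 1) t) ^ 2 / vol (F t '' M) := by
  -- Without this the value of `limUnder` would be unrelated to the limit; it holds also at the
  -- endpoints.
  have : (𝓝[Icc 0 1 \ {t}] t).NeBot := by
    rw [← accPt_principal_iff_nhdsWithin, ← uniqueDiffWithinAt_iff_accPt]
    exact uniqueDiffOn_Icc zero_lt_one t ht
  exact (hF.tendsto_transitionEnergy_div hM hk hmin ht).limUnder_eq

theorem IsMorph.derivWithin_morphJacobian (hF : IsMorph 2 M N F) (hM : IsClosedHypersurface M)
    (hk : 1 ≤ k) (hmin : IsPairwiseMinimal k M F) {p : Ambient n} (hp : p ∈ M) {t : ℝ}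
    (ht : t ∈ Icc (0 : ℝ) 1) : HasDerivWithinAt (morphJacobian M F p)
      (derivWithin (fun τ => vol (F τ '' M)) (Icc 0 1) t / vol M) (Icc 0 1) t := by
  have h1 := (((hF.contDiffOn_vol hM hk hmin).differentiableOn one_ne_zero t
    ht).hasDerivWithinAt).div_const (vol M)
  exact h1.congr (fun τ hτ => hF.morphJacobian_eq hM hk hmin hp hτ)
    (hF.morphJacobian_eq hM hk hmin hp ht)

end PairwiseMinimal

end Morphing

theorem mainTheorem8 (n : ℕ) (hn : 1 ≤ n) (k : ℕ∞) (hk : 1 ≤ k)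
    (M N : Set (Morphing.Ambient n))
    (hM : Morphing.IsClosedHypersurface M) (hN : Morphing.IsClosedHypersurface N)
    (F : ℝ → Morphing.Ambient n → Morphing.Ambient n)
    (hF : Morphing.IsMorph 2 M N F) (hmin : Morphing.IsPairwiseMinimal k M F) :
    (∀ t ∈ Icc (0 : ℝ) 1,
      Tendsto (fun s => Morphing.transitionEnergy M F s t / (s - t) ^ 2)
        (𝓝[Icc 0 1 \ {t}] t) (𝓝 (Morphing.infinitesimalDistortion M F t)) ∧
      (∀ p ∈ M, 0 < Morphing.morphJacobian M F p t ∧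
        DifferentiableWithinAt ℝ (Morphing.morphJacobian M F p) (Icc 0 1) t) ∧
      Integrable (fun p => (derivWithin (Morphing.morphJacobian M F p) (Icc 0 1) t) ^ 2 /
        Morphing.morphJacobian M F p t) (Morphing.volumeMeasure M) ∧
      Morphing.infinitesimalDistortion M F t =
        ∫ p, (derivWithin (Morphing.morphJacobian M F p) (Icc 0 1) t) ^ 2 /
          Morphing.morphJacobian M F p t ∂(Morphing.volumeMeasure M) ∧
      0 < Morphing.vol (F t '' M)) ∧
    ContDiffOn ℝ 1 (fun t => Morphing.vol (F t '' M)) (Icc 0 1) ∧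
    IntervalIntegrable (Morphing.infinitesimalDistortion M F) volume 0 1 ∧
    Morphing.totalDistortion M F =
      ∫ t in (0 : ℝ)..1,
        (derivWithin (fun τ => Morphing.vol (F τ '' M)) (Icc 0 1) t) ^ 2 /
          Morphing.vol (F t '' M) := by
  have hud : UniqueDiffOn ℝ (Icc (0 : ℝ) 1) := uniqueDiffOn_Icc zero_lt_one
  have hVc := hF.contDiffOn_vol hM hk hmin
  have hpos : ∀ t ∈ Icc (0 : ℝ) 1, 0 < Morphing.vol (F t '' M) :=
    fun t ht => (hF.isClosedHypersurface t ht).vol_pos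
  have heq : EqOn (Morphing.infinitesimalDistortion M F) (fun t =>
      (derivWithin (fun τ => Morphing.vol (F τ '' M)) (Icc 0 1) t) ^ 2 /
        Morphing.vol (F t '' M)) (Icc 0 1) :=
    fun t ht => hF.infinitesimalDistortion_eq hM hk hmin ht
  have hcont : ContinuousOn (fun t =>
      (derivWithin (fun τ => Morphing.vol (F τ '' M)) (Icc 0 1) t) ^ 2 /
        Morphing.vol (F t '' M)) (Icc 0 1) :=
    ((hVc.continuousOn_derivWithin hud le_rfl).pow 2).div hVc.continuousOn
      fun t ht => (hpos t ht).ne'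
  refine ⟨fun t ht => ?_, hVc, ?_, ?_⟩
  · have hM0 := hM.vol_pos
    have ht0 := hpos t ht
    -- With `J = V / vol M` the integrand is the constant `V'² / (V vol M)`, and integration over
    -- `M` cancels `vol M`.
    have hint : ∀ p ∈ M, (derivWithin (Morphing.morphJacobian M F p) (Icc 0 1) t) ^ 2 /
        Morphing.morphJacobian M F p t =
        (derivWithin (fun τ => Morphing.vol (F τ '' M)) (Icc 0 1) t) ^ 2 /
          Morphing.vol (F t '' M) / Morphing.vol M := fun p hp => by
      rw [(hF.derivWithin_morphJacobian hM hk hmin hp ht).derivWithin (hud t ht),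
        hF.morphJacobian_eq hM hk hmin hp ht]
      field_simp
    refine ⟨?_, fun p hp => ⟨hF.morphJacobian_pos hM hp ht,
      (hF.derivWithin_morphJacobian hM hk hmin hp ht).differentiableWithinAt⟩, ?_, ?_, ht0⟩
    · rw [heq ht]
      exact hF.tendsto_transitionEnergy_div hM hk hmin ht
    · exact hM.integrable_of_continuousOn (continuousOn_const.congr hint)
    · have h1 : ∫ p, (derivWithin (Morphing.morphJacobian M F p) (Icc 0 1) t) ^ 2 /
          Morphing.morphJacobian M F p t ∂(Morphing.volumeMeasure M) =
          ∫ _, (derivWithin (fun τ => Morphing.vol (F τ '' M)) (Icc 0 1) t) ^ 2 /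
            Morphing.vol (F t '' M) / Morphing.vol M ∂(Morphing.volumeMeasure M) :=
        setIntegral_congr_fun hM.measurableSet hint
      rw [h1, heq ht, integral_const, smul_eq_mul]
      exact (mul_div_cancel₀ _ hM0.ne').symm
  · refine ContinuousOn.intervalIntegrable ?_
    rw [uIcc_of_le zero_le_one]
    exact hcont.congr heq
  · refine intervalIntegral.integral_congr ?_
    rw [uIcc_of_le zero_le_one]
    exact heq
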